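/- Let $\mathcal H=\ell^2(\mathbb N_0)$ with Fock basis $|0\rangle,|1\rangle,\dots$ and number operator $H|m\rangle=m|m\rangle$. For $\gamma\ge 0$ the bosonic dephasing channel is $\mathcal N_\gamma(\rho)=\int_{\mathbb R} e^{-i\theta H}\rho\, e^{i\theta H}\,dg_\gamma(\theta)$, where $g_\gamma$ is the normal law with mean $0$ and variance $\gamma$ (the Dirac mass at $0$ if $\gamma=0$); in the Fock basis it multiplies the entry $\rho_{jk}$ by $e^{-\gamma(j-k)^2/2}$. Let $\gamma_1,\gamma_2\ge 0$, $q_1,q_2\ge 0$ with $q_1+q_2=1$, $E\ge 0$, and let $n\ge 0$ be an integer. On $\mathcal H^{\otimes n}$ put $$\Delta^{(n)}(\rho)=q_1\mathcal N_{\gamma_1}^{\otimes n}(\rho)-q_2\mathcal N_{\gamma_2}^{\otimes n}(\rho),\qquad H^{(n)}=\sum_{k=1}^n I\otimes\cdots\otimes \underset{k}{H}\otimes\cdots\otimes I,$$ and let $\|A\|_1=\mathrm{Tr}\sqrt{A^\dagger A}$. Call a state $\rho$ on $\mathcal H^{\otimes n}$ admissible if it is pure and $\mathrm{Tr}(\rho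 H^{(n)})\le nE$. The maximum $D$ of $\|\Delta^{(n)}(\rho)\|_1$ over admissible $\rho$ exists and is finite, and the following holds. (i) If $E\ge 1/2$, let $M=\lfloor 2E\rfloor+1$, let $T^{(\gamma)}$ be the $M\times M$ matrix with entries $e^{-\gamma(j-k)^2/2}$, $0\le j,k<M$, and let $$\alpha=\alpha_+:=\frac14\,\frac1{M^2}\,\big\|T^{(\gamma_1)}-T^{(\gamma_2)}\big\|_1^2 .$$ (ii) If $E<1/2$, let $$\alpha=\alpha_-:=\frac{E}{m_*}\Big(1-\frac{E}{m_*}\Big)\Big|e^{-\frac{m_*^2}{2}\gamma_1}-e^{-\frac{m_*^2}{2}\gamma_2}\Big|^2,$$ where $m_*$ is $1$, or a positive integer closest to $\sqrt{2\,\frac{\ln(p_1\gamma_1)-\ln(p_2\gamma_2)}{\gamma_1-\gamma_2}}$ (when $p_1\gamma_1,p_2\gamma_2>0$, $\gamma_1\ne\gamma_2$ and the radicand is nonnegative), with $(p_1,p_2)=(q_1,q_2)$ or $(p_1,p_2)=(\frac12,\frac12)$; the claim holds for each of these choices. In both cases $\alpha<1$; moreover $\alpha>0$ if $\gamma_1\neq\gamma_2$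 (and $E>0$); and $$D\ \ge\ 1-2\sqrt{q_1q_2}\,(1-\alpha)^{n/2}.$$ Furthermore there are an admissible $\rho$ and a two-outcome measurement $\{Q,I-Q\}$, $0\le Q\le I$, whose error probability satisfies $$q_1\mathrm{Tr}\big((I-Q)\,\mathcal N_{\gamma_1}^{\otimes n}(\rho)\big)+q_2\mathrm{Tr}\big(Q\,\mathcal N_{\gamma_2}^{\otimes n}(\rho)\big)\ \le\ \tfrac12\exp\!\big(n\ln\sqrt{1-\alpha}\,\big).$$ -/

import Mathlib

open MeasureTheory ProbabilityTheory
open scoped NNReal ENNReal InnerProductSpace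

noncomputable section

namespace BosonicDephasing

/-! ### Trace and trace norm -/

section Trace

variable {ι H : Type*} [NormedAddCommGroup H] [InnerProductSpace ℂ H] [CompleteSpace H]

/-- The trace `∑ i, ⟨b i, A (b i)⟩` of an operator, computed in the Hilbert basis `b`.
The sum converges absolutely whenever `A` is trace class; it is only used for such `A`. -/
def opTrace (b : HilbertBasis ι ℂ H) (A : H →L[ℂ] H) : ℂ :=
  ∑' i, ⟪b i, A (b i)⟫_ℂ

/-- The trace norm `Tr √(A† A)`, with values in `[0, ∞]`, computed in the Hilbert basis `b`. -/
def traceNorm (b : HilbertBasis ι ℂ H) (A : H →L[ℂ] H) : ℝ≥0∞ :=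
  ∑' i, ENNReal.ofReal (⟪b i, CFC.sqrt (star A * A) (b i)⟫_ℂ).re

end Trace

/-! ### The `n`-mode bosonic Hilbert space -/

/-- The Hilbert space of `n` bosonic modes: square-summable families of amplitudes indexed by the
occupation numbers `m = (m₁, …, mₙ)`, i.e. the `n`-th Hilbert tensor power of `ℓ²(ℕ)` in its
Fock basis. -/
def Fock (n : ℕ) : Type := lp (fun _ : Fin n → ℕ => ℂ) 2

instance (n : ℕ) : NormedAddCommGroup (Fock n) :=
  inferInstanceAs (NormedAddCommGroup (lp (fun _ : Fin n → ℕ => ℂ) 2))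

instance (n : ℕ) : InnerProductSpace ℂ (Fock n) :=
  inferInstanceAs (InnerProductSpace ℂ (lp (fun _ : Fin n → ℕ => ℂ) 2))

instance (n : ℕ) : CompleteSpace (Fock n) :=
  inferInstanceAs (CompleteSpace (lp (fun _ : Fin n → ℕ => ℂ) 2))

/-- The Fock basis `|m₁, …, mₙ⟩` of the `n`-mode space. -/
def fockBasis (n : ℕ) : HilbertBasis (Fin n → ℕ) ℂ (Fock n) :=
  HilbertBasis.ofRepr (LinearIsometryEquiv.refl ℂ (lp (fun _ : Fin n → ℕ => ℂ) 2))

/-- A pure state: the projector `|ψ⟩⟨ψ|` onto a unit vector. -/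
def IsPureState {n : ℕ} (ρ : Fock n →L[ℂ] Fock n) : Prop :=
  ∃ ψ : Fock n, ‖ψ‖ = 1 ∧ ρ = InnerProductSpace.rankOne ℂ ψ ψ

/-- The mean energy `Tr (ρ H⁽ⁿ⁾) ∈ [0, ∞]` of a state, where
`H⁽ⁿ⁾ = ∑ k, I ⊗ ⋯ ⊗ H ⊗ ⋯ ⊗ I` is diagonal in the Fock basis, with eigenvalue
`m₁ + ⋯ + mₙ` at `|m₁, …, mₙ⟩`. -/
def energy {n : ℕ} (ρ : Fock n →L[ℂ] Fock n) : ℝ≥0∞ :=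
  ∑' m : Fin n → ℕ, ((∑ k, m k : ℕ) : ℝ≥0∞) *
    ENNReal.ofReal (⟪fockBasis n m, ρ (fockBasis n m)⟫_ℂ).re

/-- The inputs allowed for `n` shots: pure states with `Tr (ρ H⁽ⁿ⁾) ≤ n E`. -/
def admissible (n : ℕ) (E : ℝ) : Set (Fock n →L[ℂ] Fock n) :=
  {ρ | IsPureState ρ ∧ energy ρ ≤ ENNReal.ofReal (n * E)}

/-! ### The dephasing channel -/

/-- The phase `exp (-i (θ₁ m₁ + ⋯ + θₙ mₙ))`. -/
def phase {n : ℕ} (θ : Fin n → ℝ) (m : Fin n → ℕ) : ℂ :=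
  Complex.exp (-Complex.I * ((∑ k, θ k * (m k : ℝ) : ℝ) : ℂ))

theorem norm_phase {n : ℕ} (θ : Fin n → ℝ) (m : Fin n → ℕ) : ‖phase θ m‖ = 1 := by
  simp [phase, Complex.norm_exp]

theorem memℓp_phase_mul {n : ℕ} (θ : Fin n → ℝ) (ψ : lp (fun _ : Fin n → ℕ => ℂ) 2) :
    Memℓp (fun m => phase θ m * ψ m) 2 := by
  have h := lp.memℓp ψ
  rw [memℓp_gen_iff (by norm_num)] at h ⊢
  simpa [norm_phase] using h

/-- The phase rotation `e^{-i a†a θ₁} ⊗ ⋯ ⊗ e^{-i a†a θₙ}`, diagonal in the Fock basis. -/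
def phaseRotation {n : ℕ} (θ : Fin n → ℝ) : Fock n →L[ℂ] Fock n :=
  LinearMap.mkContinuous (E := lp (fun _ : Fin n → ℕ => ℂ) 2) (F := lp (fun _ : Fin n → ℕ => ℂ) 2)
    { toFun := fun ψ => ⟨fun m => phase θ m * ψ m, memℓp_phase_mul θ ψ⟩
      map_add' := fun ψ φ => by
        ext m
        exact mul_add _ _ _
      map_smul' := fun c ψ => by
        ext m
        exact mul_left_comm _ _ _ }
    1 (fun ψ => by
      refine le_of_eq ?_
      rw [one_mul, lp.norm_eq_tsum_rpow (by norm_num), lp.norm_eq_tsum_rpow (by norm_num)]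
      refine congrArg (· ^ _) (tsum_congr fun m => ?_)
      change ‖phase θ m * ψ m‖ ^ _ = _
      rw [norm_mul, norm_phase, one_mul])

/-- The `n`-fold tensor power `N_γ ⊗ ⋯ ⊗ N_γ` of the bosonic dephasing channel
`N_γ(ρ) = ∫ p_γ(θ) e^{-i a†a θ} ρ e^{i a†a θ} dθ`, with `p_γ` the centred normal density of
variance `γ` (the Dirac mass at `0` for `γ = 0`): independent random phases in the `n` modes.
The integrand is norm continuous and bounded for every trace class `ρ`. -/
def channel (n : ℕ) (γ : ℝ≥0) (ρ : Fock n →L[ℂ] Fock n) : Fock n →L[ℂ] Fock n :=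
  ∫ θ : Fin n → ℝ, phaseRotation θ * ρ * star (phaseRotation θ)
    ∂(Measure.pi fun _ : Fin n => gaussianReal 0 γ)

/-- `Δ⁽ⁿ⁾(ρ) = q₁ N_{γ₁}^{⊗n}(ρ) - q₂ N_{γ₂}^{⊗n}(ρ)`. -/
def delta (n : ℕ) (q₁ q₂ : ℝ) (γ₁ γ₂ : ℝ≥0) (ρ : Fock n →L[ℂ] Fock n) : Fock n →L[ℂ] Fock n :=
  (q₁ : ℂ) • channel n γ₁ ρ - (q₂ : ℂ) • channel n γ₂ ρ

/-- The probability of misidentifying the channel with the input `ρ` and the two-outcome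
measurement `{Q, 1 - Q}`, where `Q` announces `γ₁`:
`q₁ Tr ((1 - Q) N_{γ₁}^{⊗n}(ρ)) + q₂ Tr (Q N_{γ₂}^{⊗n}(ρ))`. -/
def errorProb (n : ℕ) (q₁ q₂ : ℝ) (γ₁ γ₂ : ℝ≥0) (ρ Q : Fock n →L[ℂ] Fock n) : ℝ :=
  q₁ * (opTrace (fockBasis n) ((1 - Q) * channel n γ₁ ρ)).re +
    q₂ * (opTrace (fockBasis n) (Q * channel n γ₂ ρ)).re

/-! ### The constants -/

/-- The compression of the Toeplitz operator with entries `exp (-γ (i - j)² / 2)` to the span of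
the first `M` Fock states. -/
def toeplitz (M : ℕ) (γ : ℝ≥0) : Matrix (Fin M) (Fin M) ℂ :=
  Matrix.of fun i j => ((Real.exp (-(γ : ℝ) / 2 * ((i : ℝ) - (j : ℝ)) ^ 2) : ℝ) : ℂ)

/-- The trace norm of a square matrix, as an operator on Euclidean space. -/
def matrixTraceNorm {M : ℕ} (A : Matrix (Fin M) (Fin M) ℂ) : ℝ :=
  (traceNorm (EuclideanSpace.basisFun (Fin M) ℂ).toHilbertBasis
    (Matrix.toEuclideanCLM (𝕜 := ℂ) A)).toReal

/-- The constant `α₊`, with truncation to dimension `⌊2E⌋ + 1`. -/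
def alphaPlus (γ₁ γ₂ : ℝ≥0) (E : ℝ) : ℝ :=
  1 / 4 * (1 / ((⌊2 * E⌋₊ : ℝ) + 1)) ^ 2 *
    matrixTraceNorm (toeplitz (⌊2 * E⌋₊ + 1) γ₁ - toeplitz (⌊2 * E⌋₊ + 1) γ₂) ^ 2

/-- The constant `α₋`, for the two-level state on `|0⟩` and `|m⟩`. -/
def alphaMinus (γ₁ γ₂ : ℝ≥0) (E : ℝ) (m : ℕ) : ℝ :=
  E / m * (1 - E / m) *
    |Real.exp (-(m : ℝ) ^ 2 / 2 * γ₁) - Real.exp (-(m : ℝ) ^ 2 / 2 * γ₂)| ^ 2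

/-- The radicand `2 (ln (q₁ γ₁) - ln (q₂ γ₂)) / (γ₁ - γ₂)` in the definition of `m_ext`. -/
def extRadicand (q₁ q₂ : ℝ) (γ₁ γ₂ : ℝ≥0) : ℝ :=
  2 * (Real.log (q₁ * γ₁) - Real.log (q₂ * γ₂)) / ((γ₁ : ℝ) - γ₂)

/-- `m` is one of the values allowed for `m_*`: either `1`, or `m_ext`, the closest integer to
the square root of `extRadicand`, whenever this is defined and positive. -/
def IsMStar (q₁ q₂ : ℝ) (γ₁ γ₂ : ℝ≥0) (m : ℕ) : Prop :=
  m = 1 ∨ (1 ≤ m ∧ 0 < q₁ * γ₁ ∧ 0 < q₂ * γ₂ ∧ γ₁ ≠ γ₂ ∧ 0 ≤ extRadicand q₁ q₂ γ₁ γ₂ ∧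
    |(m : ℝ) - √(extRadicand q₁ q₂ γ₁ γ₂)| ≤ 1 / 2)

end BosonicDephasing

end

/-! Lower bound. Feed in n copies of a single-mode superposition `∑ a_j |ℓ_j⟩`. The outputs are
`S₁^⊗n` and `S₂^⊗n` for finite density matrices `S_i` (`outputMatrix`). Put `τ = Tr √S₁ √S₂`.
Powers–Størmer, applied to `√q₁ (√S₁)^⊗n` and `√q₂ (√S₂)^⊗n`, gives a projection whose test value is
at least `1 - 2 √(q₁q₂) τ^n`. The same projection has error probability at most `√(q₁q₂) τ^n ≤ τ^n /
2`. Hölder gives `‖S₁ - S₂‖₁² ≤ (2 - 2τ)(2 + 2τ)`, that is `τ² ≤ 1 - α` with `α = ‖S₁ - S₂‖₁² / 4`.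
Since `τ > 0`, `α < 1` (`exists_admissible_test`, `product_input_bounds`).

Both constants are this `α`. The uniform superposition of `|0⟩, …, |⌊2E⌋⟩` has mean energy `⌊2E⌋ / 2
≤ E` and gives `α₊`. The state `√(1 - E/m) |0⟩ + √(E/m) |m⟩` has energy `E` and gives `α₋`, for
every positive integer `m` when `E < 1/2`.

Maximum. The unit vectors of bounded energy form a compact set, because the energy controls the
weight on high Fock states. On it the trace norm of the output is upper semicontinuous: a small
change of the vector alters the output by a difference of positive operators of small trace
(`channel_perturbation`). Hence the supremum is attained.

Traces of positive operators are taken in `[0, ∞]`, so sums may be interchanged freely. The basic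
tool is that compressing by a contraction does not increase such a trace. -/

namespace BosonicDephasing

/-! ### Traces of positive operators -/

section PosTrace

set_option linter.unusedSectionVars false

variable {ι κ H G : Type*} [NormedAddCommGroup H] [InnerProductSpace ℂ H] [CompleteSpace H]
  [NormedAddCommGroup G] [InnerProductSpace ℂ G] [CompleteSpace G]

/-- The trace of a positive operator, with values in `[0, ∞]`. -/
noncomputable def posTrace (b : HilbertBasis ι ℂ H) (P : H →L[ℂ] H) : ℝ≥0∞ :=
  ∑' i, ENNReal.ofReal (⟪b i, P (b i)⟫_ℂ).re

theorem re_inner_nonneg_of_nonneg {P : H →L[ℂ] H} (hP : 0 ≤ P) (x : H) :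
    0 ≤ (⟪x, P x⟫_ℂ).re :=
  ((ContinuousLinearMap.nonneg_iff_isPositive P).1 hP).re_inner_nonneg_right x

theorem re_inner_mono {P N : H →L[ℂ] H} (h : P ≤ N) (x : H) :
    (⟪x, P x⟫_ℂ).re ≤ (⟪x, N x⟫_ℂ).re := by
  have := re_inner_nonneg_of_nonneg (sub_nonneg.2 h) x
  simp only [sub_apply, inner_sub_right, Complex.sub_re] at this
  linarith

theorem posTrace_add (b : HilbertBasis ι ℂ H) {P N : H →L[ℂ] H} (hP : 0 ≤ P) (hN : 0 ≤ N) :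
    posTrace b (P + N) = posTrace b P + posTrace b N := by
  simp only [posTrace]
  rw [← ENNReal.tsum_add]
  refine tsum_congr fun i => ?_
  rw [← ENNReal.ofReal_add (re_inner_nonneg_of_nonneg hP _) (re_inner_nonneg_of_nonneg hN _)]
  simp

theorem posTrace_smul (b : HilbertBasis ι ℂ H) {c : ℝ} (hc : 0 ≤ c) (P : H →L[ℂ] H) :
    posTrace b ((c : ℂ) • P) = ENNReal.ofReal c * posTrace b P := by
  simp only [posTrace]
  rw [← ENNReal.tsum_mul_left]
  refine tsum_congr fun i => ?_
  rw [← ENNReal.ofReal_mul hc]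
  simp

theorem tsum_ofReal_norm_inner_sq (b : HilbertBasis ι ℂ H) (x : H) :
    ∑' i, ENNReal.ofReal (‖⟪b i, x⟫_ℂ‖ ^ 2) = ENNReal.ofReal (‖x‖ ^ 2) := by
  have h := (b.hasSum_inner_mul_inner x x).mapL Complex.reCLM
  have h2 : HasSum (fun i => ‖⟪b i, x⟫_ℂ‖ ^ 2) (‖x‖ ^ 2) := by
    convert h using 1
    · ext i
      rw [← inner_conj_symm x (b i), Complex.conj_mul']
      simp [← Complex.ofReal_pow]
    · simp [inner_self_eq_norm_sq_to_K, ← Complex.ofReal_pow]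
  rw [← h2.tsum_eq, ENNReal.ofReal_tsum_of_nonneg (fun _ => sq_nonneg _) h2.summable]

theorem re_inner_eq_norm_sqrt_sq {P : H →L[ℂ] H} (hP : 0 ≤ P) (x : H) :
    (⟪x, P x⟫_ℂ).re = ‖CFC.sqrt P x‖ ^ 2 := by
  have hS : IsSelfAdjoint (CFC.sqrt P) := (CFC.sqrt_nonneg P).isSelfAdjoint
  have h1 : ⟪x, P x⟫_ℂ = ⟪CFC.sqrt P x, CFC.sqrt P x⟫_ℂ := by
    conv_lhs => rw [← CFC.sqrt_mul_sqrt_self P hP]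
    rw [mul_apply_eq_comp, ← ContinuousLinearMap.adjoint_inner_left,
      ContinuousLinearMap.isSelfAdjoint_iff'.1 hS]
  rw [h1, inner_self_eq_norm_sq_to_K]
  simp [← Complex.ofReal_pow]

/-- By Parseval both sides are the double sum of `|⟨b j, R (e i)⟩|²`. This Hilbert–Schmidt symmetry
stands in for cyclicity of the trace. -/
theorem tsum_ofReal_norm_sq_adjoint (b : HilbertBasis ι ℂ H) (e : HilbertBasis κ ℂ G)
    (R : G →L[ℂ] H) :
    ∑' i, ENNReal.ofReal (‖R (e i)‖ ^ 2) =
      ∑' j, ENNReal.ofReal (‖ContinuousLinearMap.adjoint R (b j)‖ ^ 2) := by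
  simp_rw [← tsum_ofReal_norm_inner_sq b, ← tsum_ofReal_norm_inner_sq e]
  rw [ENNReal.tsum_comm]
  refine tsum_congr fun i => tsum_congr fun j => ?_
  rw [ContinuousLinearMap.adjoint_inner_right, norm_inner_symm]

/-- The left side is the squared Hilbert–Schmidt norm of `√P W`. Passing to the adjoint `W† √P` puts
the contraction on the outside, where it can be dropped. -/
theorem tsum_compression_le_posTrace (b : HilbertBasis ι ℂ H) (e : HilbertBasis κ ℂ G)
    {W : G →L[ℂ] H} (hW : ‖W‖ ≤ 1) {P : H →L[ℂ] H} (hP : 0 ≤ P) :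
    ∑' i, ENNReal.ofReal (⟪W (e i), P (W (e i))⟫_ℂ).re ≤ posTrace b P := by
  have hS : ContinuousLinearMap.adjoint (CFC.sqrt P) = CFC.sqrt P :=
    ContinuousLinearMap.isSelfAdjoint_iff'.1 (CFC.sqrt_nonneg P).isSelfAdjoint
  simp_rw [posTrace, re_inner_eq_norm_sqrt_sq hP]
  have := tsum_ofReal_norm_sq_adjoint b e (CFC.sqrt P ∘L W)
  simp only [ContinuousLinearMap.comp_apply, ContinuousLinearMap.adjoint_comp, hS] at this
  rw [this]
  refine ENNReal.tsum_le_tsum fun j => ENNReal.ofReal_le_ofReal ?_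
  refine pow_le_pow_left₀ (norm_nonneg _) ?_ 2
  refine (ContinuousLinearMap.le_opNorm _ _).trans ?_
  rw [LinearIsometryEquiv.norm_map]
  exact mul_le_of_le_one_left (norm_nonneg _) hW

theorem hilbertBasis_op_ext (b : HilbertBasis ι ℂ H) {A B : H →L[ℂ] H}
    (h : ∀ i j, ⟪b i, A (b j)⟫_ℂ = ⟪b i, B (b j)⟫_ℂ) : A = B := by
  have hd : Dense ((Submodule.span ℂ (Set.range b) : Submodule ℂ H) : Set H) := by
    rw [Submodule.dense_iff_topologicalClosure_eq_top]
    exact b.dense_span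
  refine ContinuousLinearMap.ext_on hd ?_
  rintro _ ⟨j, rfl⟩
  apply b.repr.injective
  ext i
  rw [HilbertBasis.repr_apply_apply, HilbertBasis.repr_apply_apply, h]

theorem eq_zero_of_posTrace_eq_zero (b : HilbertBasis ι ℂ H) {P : H →L[ℂ] H} (hP : 0 ≤ P)
    (h : posTrace b P = 0) : P = 0 := by
  simp only [posTrace, ENNReal.tsum_eq_zero, re_inner_eq_norm_sqrt_sq hP,
    ENNReal.ofReal_eq_zero] at h
  have h0 : ∀ i, P (b i) = 0 := fun i => by
    have : CFC.sqrt P (b i) = 0 := by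
      have := h i
      rw [← norm_eq_zero]
      nlinarith [norm_nonneg (CFC.sqrt P (b i))]
    rw [← CFC.sqrt_mul_sqrt_self P hP, mul_apply_eq_comp, this, map_zero]
  exact hilbertBasis_op_ext b fun i j => by rw [h0, zero_apply]

theorem traceNorm_eq_add (b : HilbertBasis ι ℂ H) {A : H →L[ℂ] H} (hA : IsSelfAdjoint A) :
    traceNorm b A = posTrace b A⁺ + posTrace b A⁻ := by
  rw [← posTrace_add b (CFC.posPart_nonneg A) (CFC.negPart_nonneg A), CFC.posPart_add_negPart A hA]
  rfl

theorem traceNorm_eq_posTrace (b : HilbertBasis ι ℂ H) {A B : H →L[ℂ] H} (hB : 0 ≤ B)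
    (h : B * B = star A * A) : traceNorm b A = posTrace b B := by
  rw [traceNorm, CFC.sqrt_unique h hB]
  rfl

theorem traceNorm_smul (b : HilbertBasis ι ℂ H) {c : ℝ} (hc : 0 ≤ c) (A : H →L[ℂ] H) :
    traceNorm b ((c : ℂ) • A) = ENNReal.ofReal c * traceNorm b A := by
  have hB : 0 ≤ (c : ℂ) • CFC.abs A := by
    have h := (ContinuousLinearMap.nonneg_iff_isPositive _).1 (CFC.abs_nonneg A)
    rw [ContinuousLinearMap.nonneg_iff_isPositive]
    open scoped ComplexOrder in
    exact h.smul_of_nonneg (Complex.zero_le_real.2 hc)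
  rw [traceNorm_eq_posTrace b hB, posTrace_smul b hc]
  · rfl
  · rw [smul_mul_smul_comm, CFC.abs_mul_abs, star_smul, smul_mul_smul_comm]
    simp

theorem exists_contraction_posPart_approx {A : H →L[ℂ] H} (hA : IsSelfAdjoint A) {ε : ℝ}
    (hε : 0 < ε) : ∃ g : H →L[ℂ] H, IsSelfAdjoint g ∧ ‖g‖ ≤ 1 ∧ ‖A⁺ - g * A * g‖ ≤ ε := by
  -- A continuous stand-in for the indicator of `(0, ∞)`: `x f(x)²` equals `x⁺` for `x ≤ 0` and `x ≥
  -- ε`, and differs from it by at most `ε` in between.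
  let f : ℝ → ℝ := fun x => min 1 (max x 0 / ε)
  have hf : Continuous f := by fun_prop
  have hf0 : ∀ x, 0 ≤ f x := fun x => by positivity
  have hf1 : ∀ x, f x ≤ 1 := fun x => min_le_left _ _
  refine ⟨cfc f A, cfc_predicate f A, ?_, ?_⟩
  · refine norm_cfc_le zero_le_one fun x _ => ?_
    rw [Real.norm_eq_abs, abs_of_nonneg (hf0 x)]
    exact hf1 x
  · have h1 : A⁺ = cfc (fun x : ℝ => x⁺) A := by
      rw [CFC.posPart_def, cfcₙ_eq_cfc]
    have h2 : cfc f A * A * cfc f A = cfc (fun x => f x * x * f x) A := by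
      rw [cfc_mul (fun x => f x * x) f A, cfc_mul f (fun x => x) A, cfc_id' ℝ A]
    rw [h1, h2, ← cfc_sub (fun x : ℝ => x⁺) (fun x => f x * x * f x) A]
    refine norm_cfc_le hε.le fun x _ => ?_
    rcases le_or_gt x 0 with hx | hx
    · have : f x = 0 := by simp [f, max_eq_right hx]
      simp [this, posPart_eq_zero.2 hx, hε.le]
    · rw [posPart_eq_self.2 hx.le, Real.norm_eq_abs]
      rcases le_or_gt ε x with hx' | hx'
      · have : f x = 1 := by
          simp only [f, max_eq_left hx.le]
          exact min_eq_left ((one_le_div hε).2 hx')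
        simp [this, hε.le]
      · have h3 : f x * x * f x ≤ x := by
          have : f x * f x ≤ 1 := mul_le_one₀ (hf1 x) (hf0 x) (hf1 x)
          nlinarith
        have h4 : 0 ≤ f x * x * f x := by have := hf0 x; positivity
        rw [abs_of_nonneg (by linarith)]
        linarith

/-- Up to a small norm error, `(P - N)⁺` is `g (P - N) g ≤ g P g` for a contraction `g`, and
compression by `g` does not increase the trace of `P`. -/
theorem posTrace_posPart_le (b : HilbertBasis ι ℂ H) {P N : H →L[ℂ] H} (hP : 0 ≤ P)
    (hN : 0 ≤ N) : posTrace b (P - N)⁺ ≤ posTrace b P := by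
  have hA : IsSelfAdjoint (P - N) := hP.isSelfAdjoint.sub hN.isSelfAdjoint
  rw [posTrace, ENNReal.tsum_eq_iSup_sum]
  refine iSup_le fun s => ENNReal.le_of_forall_pos_le_add fun ε hε _ => ?_
  -- The norm error is paid once per vector of `s`; the `+ 1` covers an empty `s`.
  have hε' : (0 : ℝ) < ε / (s.card + 1) := by positivity
  obtain ⟨g, hg, hg1, hgA⟩ := exists_contraction_posPart_approx hA hε'
  have key : ∀ x : H, ‖x‖ = 1 → (⟪x, (P - N)⁺ x⟫_ℂ).re ≤
      (⟪g x, P (g x)⟫_ℂ).re + ε / (s.card + 1) := fun x hx => by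
    have h1 : (⟪x, ((P - N)⁺ - g * (P - N) * g) x⟫_ℂ).re ≤ ε / (s.card + 1) := by
      refine (Complex.re_le_norm _).trans ((norm_inner_le_norm _ _).trans ?_)
      rw [hx, one_mul]
      refine (ContinuousLinearMap.le_opNorm _ _).trans ?_
      rwa [hx, mul_one]
    have h2 : ⟪x, (g * (P - N) * g) x⟫_ℂ = ⟪g x, (P - N) (g x)⟫_ℂ := by
      rw [mul_apply_eq_comp, mul_apply_eq_comp,
        ← ContinuousLinearMap.adjoint_inner_left, ContinuousLinearMap.isSelfAdjoint_iff'.1 hg]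
    have h3 := re_inner_nonneg_of_nonneg hN (g x)
    rw [sub_apply, inner_sub_right, h2] at h1
    simp only [sub_apply, inner_sub_right, Complex.sub_re] at h1
    linarith
  calc ∑ i ∈ s, ENNReal.ofReal (⟪b i, (P - N)⁺ (b i)⟫_ℂ).re
      ≤ ∑ i ∈ s, (ENNReal.ofReal (⟪g (b i), P (g (b i))⟫_ℂ).re +
          ENNReal.ofReal (ε / (s.card + 1))) := by
        refine Finset.sum_le_sum fun i _ => ?_
        rw [← ENNReal.ofReal_add (re_inner_nonneg_of_nonneg hP _) hε'.le]
        exact ENNReal.ofReal_le_ofReal (key _ (b.orthonormal.1 i))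
    _ = ∑ i ∈ s, ENNReal.ofReal (⟪g (b i), P (g (b i))⟫_ℂ).re +
          ENNReal.ofReal (s.card * (ε / (s.card + 1))) := by
        rw [Finset.sum_add_distrib, Finset.sum_const, nsmul_eq_mul,
          ENNReal.ofReal_mul (by positivity), ENNReal.ofReal_natCast]
    _ ≤ posTrace b P + ε := by
        gcongr
        · exact (ENNReal.sum_le_tsum s).trans (tsum_compression_le_posTrace b b hg1 hP)
        · rw [← ENNReal.ofReal_coe_nnreal]
          refine ENNReal.ofReal_le_ofReal ?_
          rw [mul_div_assoc', div_le_iff₀ (by positivity)]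
          nlinarith [ε.2]

theorem traceNorm_sub_le (b : HilbertBasis ι ℂ H) {P N : H →L[ℂ] H} (hP : 0 ≤ P)
    (hN : 0 ≤ N) : traceNorm b (P - N) ≤ posTrace b P + posTrace b N := by
  rw [traceNorm_eq_add b (hP.isSelfAdjoint.sub hN.isSelfAdjoint)]
  refine add_le_add (posTrace_posPart_le b hP hN) ?_
  rw [← CFC.posPart_neg, neg_sub]
  exact posTrace_posPart_le b hN hP

/-- Regrouping as `(A⁺ + P) - (A⁻ + N)` reduces to a difference of positive operators.
Semicontinuity needs the triangle inequality only in this form. -/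
theorem traceNorm_add_sub_le (b : HilbertBasis ι ℂ H) {A P N : H →L[ℂ] H} (hA : IsSelfAdjoint A)
    (hP : 0 ≤ P) (hN : 0 ≤ N) :
    traceNorm b (A + (P - N)) ≤ traceNorm b A + (posTrace b P + posTrace b N) := by
  have h : A + (P - N) = (A⁺ + P) - (A⁻ + N) := by
    conv_lhs => rw [← CFC.posPart_sub_negPart A hA]
    abel
  rw [h]
  refine (traceNorm_sub_le b (add_nonneg (CFC.posPart_nonneg A) hP)
    (add_nonneg (CFC.negPart_nonneg A) hN)).trans (le_of_eq ?_)
  rw [posTrace_add b (CFC.posPart_nonneg A) hP, posTrace_add b (CFC.negPart_nonneg A) hN,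
    traceNorm_eq_add b hA]
  ring

theorem traceNorm_eq_zero (b : HilbertBasis ι ℂ H) {A : H →L[ℂ] H} (hA : IsSelfAdjoint A)
    (h : traceNorm b A = 0) : A = 0 := by
  rw [traceNorm_eq_add b hA, add_eq_zero] at h
  rw [← CFC.posPart_sub_negPart A hA,
    eq_zero_of_posTrace_eq_zero b (CFC.posPart_nonneg A) h.1,
    eq_zero_of_posTrace_eq_zero b (CFC.negPart_nonneg A) h.2, sub_zero]

/-- Testing `A` with the contractions `W₁`, `W₂` bounds its trace norm from below. -/
theorem sum_compression_sub_le_traceNorm [Fintype κ] (b : HilbertBasis ι ℂ H)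
    (e : HilbertBasis κ ℂ G) {W₁ W₂ : G →L[ℂ] H} (h₁ : ‖W₁‖ ≤ 1) (h₂ : ‖W₂‖ ≤ 1)
    {A : H →L[ℂ] H} (hA : IsSelfAdjoint A) :
    ENNReal.ofReal ((∑ i, (⟪W₁ (e i), A (W₁ (e i))⟫_ℂ).re) -
      ∑ i, (⟪W₂ (e i), A (W₂ (e i))⟫_ℂ).re) ≤ traceNorm b A := by
  have hp := CFC.posPart_nonneg A
  have hn := CFC.negPart_nonneg A
  have h1 := tsum_compression_le_posTrace b e h₁ hp
  have h2 := tsum_compression_le_posTrace b e h₂ hn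
  rw [tsum_fintype, ← ENNReal.ofReal_sum_of_nonneg
    fun i _ => re_inner_nonneg_of_nonneg (by assumption) _] at h1 h2
  rw [traceNorm_eq_add b hA]
  refine le_trans ?_ (add_le_add h1 h2)
  rw [← ENNReal.ofReal_add (Finset.sum_nonneg fun i _ => re_inner_nonneg_of_nonneg hp _)
    (Finset.sum_nonneg fun i _ => re_inner_nonneg_of_nonneg hn _), sub_eq_add_neg,
    ← Finset.sum_neg_distrib]
  -- Compare termwise through `A ≤ A⁺` and `-A ≤ A⁻`.
  refine ENNReal.ofReal_le_ofReal (add_le_add (Finset.sum_le_sum fun i _ => ?_)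
    (Finset.sum_le_sum fun i _ => ?_))
  · exact re_inner_mono (CFC.le_posPart hA) _
  · have := re_inner_mono (CFC.neg_negPart_le hA) (W₂ (e i))
    simp only [neg_apply, inner_neg_right, Complex.neg_re] at this
    linarith

end PosTrace

/-! ### Positive matrices -/

section Matrices

set_option linter.unusedSectionVars false

open Matrix
open scoped ComplexOrder

variable {ι : Type*} [Fintype ι] [DecidableEq ι]

/-- The function `g` of a Hermitian matrix, through the spectral theorem. -/
noncomputable def hermitianFun {D : Matrix ι ι ℂ} (hD : D.IsHermitian) (g : ℝ → ℝ) :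
    Matrix ι ι ℂ :=
  hD.eigenvectorUnitary.1 * diagonal (fun i => ((g (hD.eigenvalues i) : ℝ) : ℂ)) *
    star hD.eigenvectorUnitary.1

theorem hermitianFun_mul {D : Matrix ι ι ℂ} (hD : D.IsHermitian) (f g : ℝ → ℝ) :
    hermitianFun hD f * hermitianFun hD g = hermitianFun hD (fun x => f x * g x) := by
  have hU : star hD.eigenvectorUnitary.1 * hD.eigenvectorUnitary.1 = 1 :=
    (Unitary.mem_iff.1 hD.eigenvectorUnitary.2).1
  simp only [hermitianFun]
  calc _ = hD.eigenvectorUnitary.1 * diagonal (fun i => ((f (hD.eigenvalues i) : ℝ) : ℂ)) *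
      (star hD.eigenvectorUnitary.1 * hD.eigenvectorUnitary.1) *
      diagonal (fun i => ((g (hD.eigenvalues i) : ℝ) : ℂ)) * star hD.eigenvectorUnitary.1 := by
        simp only [mul_assoc]
    _ = _ := by
      rw [hU, mul_one, mul_assoc _ (diagonal _) (diagonal _), diagonal_mul_diagonal]
      simp

theorem hermitianFun_id {D : Matrix ι ι ℂ} (hD : D.IsHermitian) :
    hermitianFun hD (fun x => x) = D := by
  conv_rhs => rw [hD.spectral_theorem, Unitary.conjStarAlgAut_apply]
  rfl

theorem hermitianFun_posSemidef {D : Matrix ι ι ℂ} (hD : D.IsHermitian) {g : ℝ → ℝ}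
    (hg : ∀ i, 0 ≤ g (hD.eigenvalues i)) : (hermitianFun hD g).PosSemidef := by
  refine PosSemidef.mul_mul_conjTranspose_same (PosSemidef.diagonal fun i => ?_) _
  simpa using hg i

theorem exists_posSemidef_sqrt {S : Matrix ι ι ℂ} (hS : S.PosSemidef) :
    ∃ X : Matrix ι ι ℂ, X.PosSemidef ∧ X * X = S := by
  refine ⟨hermitianFun hS.1 Real.sqrt, hermitianFun_posSemidef _ fun i => Real.sqrt_nonneg _, ?_⟩
  rw [hermitianFun_mul]
  conv_rhs => rw [← hermitianFun_id hS.1]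
  simp only [hermitianFun]
  congr 3
  ext i
  rw [Real.mul_self_sqrt (hS.eigenvalues_nonneg i)]

/-- The spectral projection of `D` onto the positive half-line. -/
theorem exists_positive_projection {D : Matrix ι ι ℂ} (hD : D.IsHermitian) :
    ∃ q : Matrix ι ι ℂ, q.IsHermitian ∧ q * q = q ∧ q * D = D * q ∧ (q * D).PosSemidef ∧
      (q * D - D).PosSemidef := by
  let g : ℝ → ℝ := fun x => if 0 < x then 1 else 0
  have h1 : hermitianFun hD g * D = hermitianFun hD (fun x => g x * x) := by
    conv_lhs => enter [2]; rw [← hermitianFun_id hD]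
    rw [hermitianFun_mul]
  have h2 : D * hermitianFun hD g = hermitianFun hD (fun x => x * g x) := by
    conv_lhs => enter [1]; rw [← hermitianFun_id hD]
    rw [hermitianFun_mul]
  have h3 : hermitianFun hD (fun x => g x * x) - D = hermitianFun hD (fun x => g x * x - x) := by
    conv_lhs => enter [2]; rw [← hermitianFun_id hD]
    simp only [hermitianFun]
    rw [← sub_mul, ← mul_sub, diagonal_sub]
    simp
  refine ⟨hermitianFun hD g, (hermitianFun_posSemidef hD fun i => ?_).1, ?_, ?_, ?_, ?_⟩
  · simp only [g]; split_ifs <;> norm_num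
  · rw [hermitianFun_mul]
    congr 1
    ext x
    simp only [g]; split_ifs <;> norm_num
  · rw [h1, h2]
    simp_rw [mul_comm]
  · rw [h1]
    refine hermitianFun_posSemidef hD fun i => ?_
    simp only [g]; split_ifs with h
    · simpa using h.le
    · simp
  · rw [h1, h3]
    refine hermitianFun_posSemidef hD fun i => ?_
    simp only [g]; split_ifs with h
    · simp
    · simpa using not_lt.1 h

theorem re_trace_mul_nonneg {A B : Matrix ι ι ℂ} (hA : A.PosSemidef) (hB : B.PosSemidef) :
    0 ≤ (A * B).trace.re := by
  obtain ⟨X, hX, rfl⟩ := exists_posSemidef_sqrt hA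
  rw [mul_assoc, trace_mul_comm]
  have := (hB.mul_mul_conjTranspose_same X).trace_nonneg
  rw [hX.1.eq] at this
  exact (Complex.nonneg_iff.1 this).1

/-- `X² - Y²` is the average of `(X - Y)(X + Y)` and `(X + Y)(X - Y)`; cyclicity and commutation
make their traces against `q` agree. -/
theorem trace_symm_product (X Y q : Matrix ι ι ℂ) (h : q * (X - Y) = (X - Y) * q) :
    (q * (X * X - Y * Y)).trace = (q * (X - Y) * (X + Y)).trace := by
  have h1 : (q * ((X + Y) * (X - Y))).trace = (q * (X - Y) * (X + Y)).trace := by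
    rw [← mul_assoc, trace_mul_comm, ← mul_assoc, h]
  have h2 : (2 : ℂ) * (q * (X * X - Y * Y)).trace =
      (q * (X - Y) * (X + Y)).trace + (q * ((X + Y) * (X - Y))).trace := by
    rw [← trace_add, ← smul_eq_mul, ← trace_smul]
    congr 1
    rw [two_smul]
    noncomm_ring
  rw [h1] at h2
  linear_combination h2 / 2

/-- The **Powers–Størmer inequality**, with an explicit optimal test. -/
theorem exists_projection_powers_stormer {X Y : Matrix ι ι ℂ} (hX : X.PosSemidef)
    (hY : Y.PosSemidef) :
    ∃ q : Matrix ι ι ℂ, q.IsHermitian ∧ q * q = q ∧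
      ((X - Y) * (X - Y)).trace.re ≤
        2 * (q * (X * X - Y * Y)).trace.re - (X * X - Y * Y).trace.re := by
  obtain ⟨q, hq, hqq, hc, hp, hn⟩ := exists_positive_projection (hX.1.sub hY.1)
  refine ⟨q, hq, hqq, ?_⟩
  have h1 := re_trace_mul_nonneg hp hY
  have h2 := re_trace_mul_nonneg hn hX
  have h3 := trace_symm_product X Y q hc
  have h4 := trace_symm_product X Y 1 (by simp)
  rw [one_mul, one_mul] at h4
  -- With `D = X - Y`, write `X + Y` as `D + 2Y` against `qD` and as `2X - D` against `qD - D`. The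
  -- terms in `Y` and `X` have nonnegative trace, and the rest adds up to `Tr D²`.
  have h5 : q * (X - Y) * (X + Y) =
      q * (X - Y) * (X - Y) + (q * (X - Y) * Y + q * (X - Y) * Y) := by noncomm_ring
  have h6 : q * (X - Y) * (X + Y) - (X - Y) * (X + Y) =
      (X - Y) * (X - Y) - q * (X - Y) * (X - Y) +
        ((q * (X - Y) - (X - Y)) * X + (q * (X - Y) - (X - Y)) * X) := by noncomm_ring
  have h5' := congrArg (fun Z => (trace Z).re) h5
  have h6' := congrArg (fun Z => (trace Z).re) h6
  simp only [trace_add, trace_sub, Complex.add_re, Complex.sub_re] at h5' h6'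
  rw [h3, h4]
  linarith

/-! ### Tensor powers of matrices -/

/-- The `n`-th tensor power of a matrix, indexed by families of indices. -/
def tensorPow (n : ℕ) (A : Matrix ι ι ℂ) : Matrix (Fin n → ι) (Fin n → ι) ℂ :=
  Matrix.of fun i j => ∏ k, A (i k) (j k)

theorem tensorPow_mul (n : ℕ) (A B : Matrix ι ι ℂ) :
    tensorPow n A * tensorPow n B = tensorPow n (A * B) := by
  ext i j
  simp only [tensorPow, mul_apply, of_apply, ← Finset.prod_mul_distrib]
  rw [Finset.prod_univ_sum, Fintype.piFinset_univ]

theorem tensorPow_conjTranspose (n : ℕ) (A : Matrix ι ι ℂ) :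
    (tensorPow n A)ᴴ = tensorPow n Aᴴ := by
  ext i j
  simp [tensorPow]

theorem trace_tensorPow (n : ℕ) (A : Matrix ι ι ℂ) : (tensorPow n A).trace = A.trace ^ n := by
  have h := Finset.prod_univ_sum (fun _ : Fin n => (Finset.univ : Finset ι)) fun _ i => A i i
  rw [Finset.prod_const, Finset.card_univ, Fintype.card_fin, Fintype.piFinset_univ] at h
  exact h.symm

theorem tensorPow_posSemidef (n : ℕ) {A : Matrix ι ι ℂ} (hA : A.PosSemidef) :
    (tensorPow n A).PosSemidef := by
  obtain ⟨X, hX, rfl⟩ := exists_posSemidef_sqrt hA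
  have := posSemidef_conjTranspose_mul_self (tensorPow n X)
  rwa [tensorPow_conjTranspose, hX.1.eq, tensorPow_mul] at this

/-! ### The trace norm of a matrix -/

theorem inner_toEuclideanCLM_basis (A : Matrix ι ι ℂ) (i j : ι) :
    ⟪(EuclideanSpace.basisFun ι ℂ).toHilbertBasis i,
      toEuclideanCLM (𝕜 := ℂ) A ((EuclideanSpace.basisFun ι ℂ).toHilbertBasis j)⟫_ℂ = A i j := by
  simp [PiLp.inner_apply, ofLp_toEuclideanCLM]

theorem toEuclideanCLM_nonneg {A : Matrix ι ι ℂ} (hA : A.PosSemidef) :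
    0 ≤ toEuclideanCLM (𝕜 := ℂ) A := by
  obtain ⟨X, hX, rfl⟩ := exists_posSemidef_sqrt hA
  have := star_mul_self_nonneg (toEuclideanCLM (𝕜 := ℂ) X)
  rwa [← map_star, star_eq_conjTranspose, hX.1.eq, ← map_mul] at this

theorem posTrace_toEuclideanCLM {A : Matrix ι ι ℂ} (hA : A.PosSemidef) :
    posTrace (EuclideanSpace.basisFun ι ℂ).toHilbertBasis (toEuclideanCLM (𝕜 := ℂ) A) =
      ENNReal.ofReal A.trace.re := by
  simp only [posTrace, inner_toEuclideanCLM_basis, tsum_fintype]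
  rw [← ENNReal.ofReal_sum_of_nonneg fun i _ => (Complex.nonneg_iff.1 (hA.diag_nonneg (i := i))).1]
  simp [trace]

theorem matrixTraceNorm_nonneg {M : ℕ} (A : Matrix (Fin M) (Fin M) ℂ) : 0 ≤ matrixTraceNorm A :=
  ENNReal.toReal_nonneg

theorem matrixTraceNorm_sub_le {M : ℕ} {P N : Matrix (Fin M) (Fin M) ℂ} (hP : P.PosSemidef)
    (hN : N.PosSemidef) : matrixTraceNorm (P - N) ≤ P.trace.re + N.trace.re := by
  have hp := (Complex.nonneg_iff.1 hP.trace_nonneg).1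
  have hn := (Complex.nonneg_iff.1 hN.trace_nonneg).1
  have h := traceNorm_sub_le (EuclideanSpace.basisFun (Fin M) ℂ).toHilbertBasis
    (toEuclideanCLM_nonneg hP) (toEuclideanCLM_nonneg hN)
  rw [posTrace_toEuclideanCLM hP, posTrace_toEuclideanCLM hN, ← map_sub,
    ← ENNReal.ofReal_add hp hn] at h
  exact ENNReal.toReal_le_of_le_ofReal (add_nonneg hp hn) h

theorem matrixTraceNorm_pos {M : ℕ} {A : Matrix (Fin M) (Fin M) ℂ} (hA : A.IsHermitian)
    (h0 : A ≠ 0) : 0 < matrixTraceNorm A := by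
  refine ENNReal.toReal_pos (fun h => h0 ?_) ?_
  · have hs : IsSelfAdjoint (toEuclideanCLM (𝕜 := ℂ) A) := by
      rw [IsSelfAdjoint, ← map_star, star_eq_conjTranspose, hA.eq]
    exact (map_eq_zero_iff _ (toEuclideanCLM (n := Fin M) (𝕜 := ℂ)).injective).1
      (traceNorm_eq_zero _ hs h)
  · simp [traceNorm, tsum_fintype]

/-- The Hölder inequality `‖X² - Y²‖₁ ≤ ‖X - Y‖₂ ‖X + Y‖₂`. -/
theorem matrixTraceNorm_sq_sub_sq_le {M : ℕ} {X Y : Matrix (Fin M) (Fin M) ℂ}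
    (hX : X.IsHermitian) (hY : Y.IsHermitian) :
    matrixTraceNorm (X * X - Y * Y) ^ 2 ≤
      ((X - Y) * (X - Y)).trace.re * ((X + Y) * (X + Y)).trace.re := by
  set N := matrixTraceNorm (X * X - Y * Y) with hN
  set x := ((X - Y) * (X - Y)).trace.re with hx
  set y := ((X + Y) * (X + Y)).trace.re with hy
  have sq_psd : ∀ {Z : Matrix (Fin M) (Fin M) ℂ}, Z.IsHermitian → (Z * Z).PosSemidef := by
    intro Z hZ
    have := posSemidef_conjTranspose_mul_self Z
    rwa [hZ.eq] at this
  have hx0 : 0 ≤ x := (Complex.nonneg_iff.1 (sq_psd (hX.sub hY)).trace_nonneg).1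
  have hy0 : 0 ≤ y := (Complex.nonneg_iff.1 (sq_psd (hX.add hY)).trace_nonneg).1
  have smul_herm : ∀ (s : ℝ) {Z : Matrix (Fin M) (Fin M) ℂ}, Z.IsHermitian →
      ((s : ℂ) • Z).IsHermitian := by
    intro s Z hZ
    rw [IsHermitian, conjTranspose_smul, hZ.eq]
    simp
  -- `X² - Y² = P² - R²` with `P, R = (s (X - Y) ± s⁻¹ (X + Y)) / 2`. So the trace norm is at most
  -- `Tr P² + Tr R²`, which is the right-hand side.
  have key : ∀ s : ℝ, 0 < s → N ≤ (s ^ 2 * x + y / s ^ 2) / 2 := by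
    intro s hs
    set c : ℂ := (((1 / 2 : ℝ) * s : ℝ) : ℂ) with hc
    set d : ℂ := (((1 / 2 : ℝ) * s⁻¹ : ℝ) : ℂ) with hd
    have hcd : c * d = 1 / 4 := by
      rw [hc, hd, ← Complex.ofReal_mul]
      have : (1 / 2 : ℝ) * s * ((1 / 2 : ℝ) * s⁻¹) = 1 / 4 := by field_simp; norm_num
      rw [this]; norm_num
    have hp : (c • (X - Y) + d • (X + Y)).IsHermitian :=
      (smul_herm _ (hX.sub hY)).add (smul_herm _ (hX.add hY))
    have hn : (c • (X - Y) - d • (X + Y)).IsHermitian :=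
      (smul_herm _ (hX.sub hY)).sub (smul_herm _ (hX.add hY))
    have hdiff : X * X - Y * Y =
        (c • (X - Y) + d • (X + Y)) * (c • (X - Y) + d • (X + Y)) -
          (c • (X - Y) - d • (X + Y)) * (c • (X - Y) - d • (X + Y)) := by
      have h1 : (c • (X - Y) + d • (X + Y)) * (c • (X - Y) + d • (X + Y)) -
          (c • (X - Y) - d • (X + Y)) * (c • (X - Y) - d • (X + Y)) =
          (2 * (c * d)) • ((X - Y) * (X + Y) + (X + Y) * (X - Y)) := by
        generalize X - Y = U
        generalize X + Y = V
        simp only [add_mul, mul_add, sub_mul, mul_sub, smul_mul_smul_comm, smul_add]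
        rw [mul_comm d c]
        module
      have h2 : (X - Y) * (X + Y) + (X + Y) * (X - Y) = (2 : ℂ) • (X * X - Y * Y) := by
        rw [two_smul]; noncomm_ring
      rw [h1, h2, smul_smul, hcd]
      norm_num
    have h := matrixTraceNorm_sub_le (sq_psd hp) (sq_psd hn)
    rw [← hdiff, ← hN, ← Complex.add_re, ← trace_add] at h
    have hsum : (c • (X - Y) + d • (X + Y)) * (c • (X - Y) + d • (X + Y)) +
          (c • (X - Y) - d • (X + Y)) * (c • (X - Y) - d • (X + Y)) =
          (2 * c ^ 2) • ((X - Y) * (X - Y)) + (2 * d ^ 2) • ((X + Y) * (X + Y)) := by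
      generalize X - Y = U
      generalize X + Y = V
      simp only [add_mul, mul_add, sub_mul, mul_sub, smul_mul_smul_comm]
      module
    rw [hsum, trace_add, trace_smul, trace_smul, smul_eq_mul, smul_eq_mul] at h
    have e1 : (2 * c ^ 2 : ℂ) = ((s ^ 2 / 2 : ℝ) : ℂ) := by
      rw [hc]; push_cast; ring
    have e2 : (2 * d ^ 2 : ℂ) = ((1 / (2 * s ^ 2) : ℝ) : ℂ) := by
      rw [hd]; push_cast; field_simp
    rw [e1, e2, Complex.add_re, Complex.re_ofReal_mul, Complex.re_ofReal_mul, ← hx, ← hy] at h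
    refine h.trans (le_of_eq ?_)
    field_simp
  have hN0 : 0 ≤ N := matrixTraceNorm_nonneg _
  rcases hN0.eq_or_lt with h0 | h0
  · simpa [← h0] using mul_nonneg hx0 hy0
  rcases hx0.eq_or_lt with hx' | hx'
  -- If `x = 0`, the choice `s² = (y + 1) / N` yields `N ≤ N / 2`.
  · exfalso
    have hpos : (0 : ℝ) < (y + 1) / N := by positivity
    have := key (√((y + 1) / N)) (Real.sqrt_pos.2 hpos)
    rw [Real.sq_sqrt hpos.le, ← hx'] at this
    have h2 : y / ((y + 1) / N) ≤ N := by
      rw [div_div_eq_mul_div, div_le_iff₀ (by positivity)]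
      nlinarith
    linarith
  -- The choice `s² = N / x` turns the bound into `N ≤ (N + xy / N) / 2`, that is `N² ≤ xy`, with no
  -- separate case `y = 0`.
  · have hpos : (0 : ℝ) < N / x := by positivity
    have := key (√(N / x)) (Real.sqrt_pos.2 hpos)
    rw [Real.sq_sqrt hpos.le, div_mul_cancel₀ _ hx'.ne', div_div_eq_mul_div] at this
    have h2 : N ≤ y * x / N := by linarith
    rw [le_div_iff₀ h0] at h2
    nlinarith

/-- The matrix squares to `d² I`, so its absolute value is `|d| I`. -/
theorem matrixTraceNorm_antidiagonal (d : ℝ) :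
    matrixTraceNorm !![0, (d : ℂ); (d : ℂ), 0] = 2 * |d| := by
  have hp : (diagonal fun _ : Fin 2 => ((|d| : ℝ) : ℂ)).PosSemidef :=
    PosSemidef.diagonal fun _ => Complex.zero_le_real.2 (abs_nonneg d)
  have h : (diagonal fun _ : Fin 2 => ((|d| : ℝ) : ℂ)) * (diagonal fun _ => ((|d| : ℝ) : ℂ)) =
      star !![0, (d : ℂ); (d : ℂ), 0] * !![0, (d : ℂ); (d : ℂ), 0] := by
    rw [diagonal_mul_diagonal, ← Complex.ofReal_mul, abs_mul_abs_self]
    ext i j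
    fin_cases i <;> fin_cases j <;> simp [mul_apply, star_eq_conjTranspose]
  rw [matrixTraceNorm, traceNorm_eq_posTrace _ (toEuclideanCLM_nonneg hp)
    (by rw [← map_star, ← map_mul, ← map_mul, h]), posTrace_toEuclideanCLM hp]
  simp [trace]

end Matrices

/-! ### The dephasing channel on pure states -/

section Channel

open InnerProductSpace

theorem inner_fockBasis_phaseRotation {n : ℕ} (θ : Fin n → ℝ) (m : Fin n → ℕ) (ψ : Fock n) :
    ⟪fockBasis n m, phaseRotation θ ψ⟫_ℂ = phase θ m * ⟪fockBasis n m, ψ⟫_ℂ := by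
  rw [← HilbertBasis.repr_apply_apply, ← HilbertBasis.repr_apply_apply]
  rfl

theorem fock_ext {n : ℕ} {ψ φ : Fock n}
    (h : ∀ m, ⟪fockBasis n m, ψ⟫_ℂ = ⟪fockBasis n m, φ⟫_ℂ) : ψ = φ := by
  apply (fockBasis n).repr.injective
  ext m
  rw [HilbertBasis.repr_apply_apply, HilbertBasis.repr_apply_apply, h]

theorem inner_fockBasis_fockBasis {n : ℕ} (i j : Fin n → ℕ) :
    ⟪fockBasis n i, fockBasis n j⟫_ℂ = if i = j then 1 else 0 :=
  orthonormal_iff_ite.1 (fockBasis n).orthonormal i j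

theorem phaseRotation_fockBasis {n : ℕ} (θ : Fin n → ℝ) (m : Fin n → ℕ) :
    phaseRotation θ (fockBasis n m) = phase θ m • fockBasis n m := by
  refine fock_ext fun j => ?_
  rw [inner_fockBasis_phaseRotation, inner_smul_right, inner_fockBasis_fockBasis]
  split_ifs with h
  · rw [h]
  · simp

theorem norm_phaseRotation_apply {n : ℕ} (θ : Fin n → ℝ) (ψ : Fock n) :
    ‖phaseRotation θ ψ‖ = ‖ψ‖ := by
  have h := tsum_ofReal_norm_inner_sq (fockBasis n) (phaseRotation θ ψ)
  simp_rw [inner_fockBasis_phaseRotation, norm_mul, norm_phase, one_mul] at h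
  rw [tsum_ofReal_norm_inner_sq, ENNReal.ofReal_eq_ofReal_iff (by positivity) (by positivity)] at h
  exact ((sq_eq_sq₀ (norm_nonneg _) (norm_nonneg _)).1 h).symm

theorem continuous_phase {n : ℕ} (m : Fin n → ℕ) : Continuous fun θ : Fin n → ℝ => phase θ m := by
  unfold phase
  fun_prop

/-- On finite superpositions continuity is explicit; the rotations are isometries, so truncations of
`ψ` converge uniformly in `θ`. -/
theorem continuous_phaseRotation_apply {n : ℕ} (ψ : Fock n) :
    Continuous fun θ : Fin n → ℝ => phaseRotation θ ψ := by
  let S : Finset (Fin n → ℕ) → Fock n := fun s =>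
    ∑ m ∈ s, (fockBasis n).repr ψ m • fockBasis n m
  have hS : Filter.Tendsto S Filter.atTop (nhds ψ) := (fockBasis n).hasSum_repr ψ
  refine TendstoUniformly.continuous (F := fun s (θ : Fin n → ℝ) => phaseRotation θ (S s))
    (p := Filter.atTop) ?_ (Filter.Frequently.of_forall fun s => ?_)
  · rw [Metric.tendstoUniformly_iff]
    intro ε hε
    filter_upwards [Metric.tendsto_nhds.1 hS ε hε] with s hs θ
    rwa [dist_eq_norm, ← map_sub, norm_phaseRotation_apply, ← dist_eq_norm, dist_comm]
  · simp only [S, map_sum, map_smul, phaseRotation_fockBasis]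
    refine continuous_finsetSum _ fun m _ => ?_
    have h : Continuous fun θ : Fin n → ℝ => phase θ m • fockBasis n m :=
      (continuous_phase m).smul continuous_const
    exact h.const_smul ((fockBasis n).repr ψ m)

theorem phaseRotation_conj_rankOne {n : ℕ} (θ : Fin n → ℝ) (ψ : Fock n) :
    phaseRotation θ * rankOne ℂ ψ ψ * star (phaseRotation θ) =
      rankOne ℂ (phaseRotation θ ψ) (phaseRotation θ ψ) := by
  ext1 x
  simp only [mul_apply_eq_comp, rankOne_apply, map_smul]
  rw [ContinuousLinearMap.star_eq_adjoint, ContinuousLinearMap.adjoint_inner_right]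

/-- Strong continuity of the rotations suffices: the rotated projector is `|Uψ⟩⟨Uψ|`, which depends
norm-continuously on `Uψ`. -/
theorem integrable_channel {n : ℕ} (γ : ℝ≥0) (ψ : Fock n) :
    Integrable (fun θ : Fin n → ℝ =>
      phaseRotation θ * rankOne ℂ ψ ψ * star (phaseRotation θ))
      (Measure.pi fun _ : Fin n => gaussianReal 0 γ) := by
  simp_rw [phaseRotation_conj_rankOne]
  refine Integrable.of_bound (C := ‖ψ‖ * ‖ψ‖) (Continuous.aestronglyMeasurable ?_)
    (Filter.Eventually.of_forall fun θ => ?_)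
  · have h := continuous_phaseRotation_apply ψ
    exact (ContinuousLinearMap.smulRightL ℂ (Fock n) (Fock n)).continuous₂.comp
      (((innerSL ℂ).continuous.comp h).prodMk h)
  · rw [norm_rankOne, norm_phaseRotation_apply]

theorem inner_channel {n : ℕ} (γ : ℝ≥0) (ψ x y : Fock n) :
    ⟪x, channel n γ (rankOne ℂ ψ ψ) y⟫_ℂ =
      ∫ θ, ⟪phaseRotation θ ψ, y⟫_ℂ * ⟪x, phaseRotation θ ψ⟫_ℂ
        ∂(Measure.pi fun _ : Fin n => gaussianReal 0 γ) := by
  have hi := integrable_channel γ ψ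
  rw [channel, ContinuousLinearMap.integral_apply hi, ← integral_inner (hi.apply_continuousLinearMap y)]
  simp_rw [phaseRotation_conj_rankOne, rankOne_apply, inner_smul_right]

theorem channel_nonneg {n : ℕ} (γ : ℝ≥0) (ψ : Fock n) : 0 ≤ channel n γ (rankOne ℂ ψ ψ) := by
  rw [ContinuousLinearMap.nonneg_iff_isPositive, ContinuousLinearMap.isPositive_iff_complex]
  intro x
  have h : ⟪x, channel n γ (rankOne ℂ ψ ψ) x⟫_ℂ =
      ((∫ θ, ‖⟪x, phaseRotation θ ψ⟫_ℂ‖ ^ 2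
        ∂(Measure.pi fun _ : Fin n => gaussianReal 0 γ) : ℝ) : ℂ) := by
    rw [inner_channel, ← integral_complex_ofReal]
    refine integral_congr_ae (Filter.Eventually.of_forall fun θ => ?_)
    simp only []
    rw [← inner_conj_symm _ x, Complex.conj_mul']
    simp
  have h2 : ⟪channel n γ (rankOne ℂ ψ ψ) x, x⟫_ℂ =
      ((∫ θ, ‖⟪x, phaseRotation θ ψ⟫_ℂ‖ ^ 2
        ∂(Measure.pi fun _ : Fin n => gaussianReal 0 γ) : ℝ) : ℂ) := by
    rw [← inner_conj_symm, h, Complex.conj_ofReal]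
  rw [h2]
  refine ⟨by simp, ?_⟩
  simpa using integral_nonneg fun θ => sq_nonneg ‖⟪x, phaseRotation θ ψ⟫_ℂ‖

/-- The factor by which the dephasing channel damps a matrix entry. -/
noncomputable def decay {n : ℕ} (γ : ℝ≥0) (i j : Fin n → ℕ) : ℝ :=
  ∏ k, Real.exp (-(γ : ℝ) / 2 * ((i k : ℝ) - (j k : ℝ)) ^ 2)

theorem integral_phase_mul_conj {n : ℕ} (γ : ℝ≥0) (i j : Fin n → ℕ) :
    ∫ θ, phase θ i * (starRingEnd ℂ) (phase θ j)
      ∂(Measure.pi fun _ : Fin n => gaussianReal 0 γ) = decay γ i j := by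
  have h : ∀ θ : Fin n → ℝ, phase θ i * (starRingEnd ℂ) (phase θ j) =
      ∏ k, Complex.exp ((((j k : ℝ) - i k : ℝ) : ℂ) * θ k * Complex.I) := fun θ => by
    rw [phase, phase, ← Complex.exp_conj, ← Complex.exp_add, ← Complex.exp_sum]
    congr 1
    simp only [map_mul, map_neg, Complex.conj_I, Complex.conj_ofReal]
    push_cast
    rw [Finset.mul_sum, Finset.mul_sum, ← Finset.sum_add_distrib]
    refine Finset.sum_congr rfl fun k _ => ?_
    ring
  simp_rw [h]
  -- Independence of the modes: each factor is the characteristic function of the Gaussian at `j k -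
  -- i k`.
  rw [integral_fintype_prod_eq_prod
    (fun k (x : ℝ) => Complex.exp ((((j k : ℝ) - i k : ℝ) : ℂ) * x * Complex.I))]
  simp_rw [← charFun_apply_real, charFun_gaussianReal, decay]
  rw [Complex.ofReal_prod]
  refine Finset.prod_congr rfl fun k _ => ?_
  rw [Complex.ofReal_exp]
  congr 1
  push_cast
  ring

theorem inner_channel_fockBasis {n : ℕ} (γ : ℝ≥0) (ψ : Fock n) (i j : Fin n → ℕ) :
    ⟪fockBasis n i, channel n γ (rankOne ℂ ψ ψ) (fockBasis n j)⟫_ℂ =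
      ⟪fockBasis n i, ψ⟫_ℂ * ⟪ψ, fockBasis n j⟫_ℂ * decay γ i j := by
  rw [inner_channel, ← integral_phase_mul_conj, ← integral_const_mul]
  refine integral_congr_ae (Filter.Eventually.of_forall fun θ => ?_)
  simp only []
  rw [← inner_conj_symm (phaseRotation θ ψ), inner_fockBasis_phaseRotation,
    inner_fockBasis_phaseRotation, map_mul, inner_conj_symm]
  ring

theorem decay_self {n : ℕ} (γ : ℝ≥0) (i : Fin n → ℕ) : decay γ i i = 1 := by
  simp [decay]

theorem inner_mul_inner_self {n : ℕ} (ψ x : Fock n) :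
    ⟪x, ψ⟫_ℂ * ⟪ψ, x⟫_ℂ = ((‖⟪x, ψ⟫_ℂ‖ ^ 2 : ℝ) : ℂ) := by
  rw [← inner_conj_symm ψ x, Complex.mul_conj']
  simp

theorem posTrace_channel {n : ℕ} (γ : ℝ≥0) (ψ : Fock n) :
    posTrace (fockBasis n) (channel n γ (rankOne ℂ ψ ψ)) = ENNReal.ofReal (‖ψ‖ ^ 2) := by
  simp_rw [posTrace, inner_channel_fockBasis, decay_self, inner_mul_inner_self,
    Complex.ofReal_one, mul_one, Complex.ofReal_re]
  exact tsum_ofReal_norm_inner_sq _ _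

theorem energy_rankOne {n : ℕ} (ψ : Fock n) :
    energy (rankOne ℂ ψ ψ) =
      ∑' m : Fin n → ℕ, ((∑ k, m k : ℕ) : ℝ≥0∞) *
        ENNReal.ofReal (‖⟪fockBasis n m, ψ⟫_ℂ‖ ^ 2) := by
  refine tsum_congr fun m => ?_
  rw [rankOne_apply, inner_smul_right, mul_comm (⟪ψ, _⟫_ℂ), inner_mul_inner_self,
    Complex.ofReal_re]

theorem isSelfAdjoint_ofReal_smul {n : ℕ} (c : ℝ) {A : Fock n →L[ℂ] Fock n}
    (hA : IsSelfAdjoint A) : IsSelfAdjoint ((c : ℂ) • A) := by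
  rw [IsSelfAdjoint, star_smul, hA.star_eq]
  simp

theorem delta_isSelfAdjoint {n : ℕ} (q₁ q₂ : ℝ) (γ₁ γ₂ : ℝ≥0) (ψ : Fock n) :
    IsSelfAdjoint (delta n q₁ q₂ γ₁ γ₂ (rankOne ℂ ψ ψ)) :=
  (isSelfAdjoint_ofReal_smul q₁ (channel_nonneg γ₁ ψ).isSelfAdjoint).sub
    (isSelfAdjoint_ofReal_smul q₂ (channel_nonneg γ₂ ψ).isSelfAdjoint)

theorem ofReal_smul_nonneg {n : ℕ} {c : ℝ} (hc : 0 ≤ c) {A : Fock n →L[ℂ] Fock n}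
    (hA : 0 ≤ A) : 0 ≤ (c : ℂ) • A := by
  rw [ContinuousLinearMap.nonneg_iff_isPositive] at hA ⊢
  open scoped ComplexOrder in
  exact hA.smul_of_nonneg (Complex.zero_le_real.2 hc)

end Channel

/-! ### Existence of the maximum -/

section Maximum

open InnerProductSpace

/-- The cross terms `|φ⟩⟨u| + |u⟩⟨φ|` come from expanding the projector on `sφ - s⁻¹u`. This writes
the change as a difference of positive outputs; a small `s`, and then a small `u`, makes all their
traces small. -/
theorem channel_perturbation {n : ℕ} (γ : ℝ≥0) (φ u : Fock n) {s : ℝ} (hs : s ≠ 0) :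
    channel n γ (rankOne ℂ (φ + u) (φ + u)) = channel n γ (rankOne ℂ φ φ) +
      (((s ^ 2 : ℝ) : ℂ) • channel n γ (rankOne ℂ φ φ) +
        ((1 + (s⁻¹) ^ 2 : ℝ) : ℂ) • channel n γ (rankOne ℂ u u) -
        channel n γ (rankOne ℂ ((s : ℂ) • φ - ((s⁻¹ : ℝ) : ℂ) • u)
          ((s : ℂ) • φ - ((s⁻¹ : ℝ) : ℂ) • u))) := by
  refine hilbertBasis_op_ext (fockBasis n) fun i j => ?_
  simp only [add_apply, sub_apply, smul_apply, inner_add_right, inner_sub_right, inner_smul_right,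
    inner_channel_fockBasis, inner_add_left, inner_sub_left, inner_smul_left, Complex.conj_ofReal]
  have hs' : (s : ℂ) ≠ 0 := Complex.ofReal_ne_zero.2 hs
  push_cast
  field_simp
  ring

theorem posTrace_ofReal_smul_channel {n : ℕ} (γ : ℝ≥0) (ψ : Fock n) {c : ℝ} (hc : 0 ≤ c) :
    posTrace (fockBasis n) ((c : ℂ) • channel n γ (rankOne ℂ ψ ψ)) =
      ENNReal.ofReal (c * ‖ψ‖ ^ 2) := by
  rw [posTrace_smul _ hc, posTrace_channel, ENNReal.ofReal_mul hc]

theorem traceNorm_delta_perturbation_le {n : ℕ} {q₁ q₂ : ℝ} (hq₁ : 0 ≤ q₁) (hq₂ : 0 ≤ q₂)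
    (hq : q₁ + q₂ = 1) (γ₁ γ₂ : ℝ≥0) (φ u : Fock n) {s : ℝ} (hs : s ≠ 0) :
    traceNorm (fockBasis n) (delta n q₁ q₂ γ₁ γ₂ (rankOne ℂ (φ + u) (φ + u))) ≤
      traceNorm (fockBasis n) (delta n q₁ q₂ γ₁ γ₂ (rankOne ℂ φ φ)) +
        ENNReal.ofReal (s ^ 2 * ‖φ‖ ^ 2 + (1 + (s⁻¹) ^ 2) * ‖u‖ ^ 2 +
          ‖(s : ℂ) • φ - ((s⁻¹ : ℝ) : ℂ) • u‖ ^ 2) := by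
  have ha : 0 ≤ s ^ 2 := sq_nonneg s
  have hc : 0 ≤ 1 + (s⁻¹) ^ 2 := by positivity
  set w := (s : ℂ) • φ - ((s⁻¹ : ℝ) : ℂ) • u with hw
  have nn : ∀ {c : ℝ} (_ : 0 ≤ c) (γ : ℝ≥0) (ψ : Fock n),
      0 ≤ (c : ℂ) • channel n γ (rankOne ℂ ψ ψ) :=
    fun hc γ ψ => ofReal_smul_nonneg hc (channel_nonneg γ ψ)
  have h1 := nn (mul_nonneg hq₁ ha) γ₁ φ
  have h2 := nn (mul_nonneg hq₁ hc) γ₁ u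
  have h3 := nn hq₂ γ₂ w
  have h1' := nn (mul_nonneg hq₂ ha) γ₂ φ
  have h2' := nn (mul_nonneg hq₂ hc) γ₂ u
  have h3' := nn hq₁ γ₁ w
  have hd : delta n q₁ q₂ γ₁ γ₂ (rankOne ℂ (φ + u) (φ + u)) =
      delta n q₁ q₂ γ₁ γ₂ (rankOne ℂ φ φ) +
      ((((q₁ * s ^ 2 : ℝ) : ℂ) • channel n γ₁ (rankOne ℂ φ φ) +
        ((q₁ * (1 + (s⁻¹) ^ 2) : ℝ) : ℂ) • channel n γ₁ (rankOne ℂ u u) +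
        (q₂ : ℂ) • channel n γ₂ (rankOne ℂ w w)) -
      (((q₂ * s ^ 2 : ℝ) : ℂ) • channel n γ₂ (rankOne ℂ φ φ) +
        ((q₂ * (1 + (s⁻¹) ^ 2) : ℝ) : ℂ) • channel n γ₂ (rankOne ℂ u u) +
        (q₁ : ℂ) • channel n γ₁ (rankOne ℂ w w))) := by
    simp only [delta]
    rw [channel_perturbation γ₁ φ u hs, channel_perturbation γ₂ φ u hs, ← hw]
    simp only [Complex.ofReal_mul]
    module
  rw [hd]
  refine (traceNorm_add_sub_le _ (delta_isSelfAdjoint q₁ q₂ γ₁ γ₂ φ)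
    (add_nonneg (add_nonneg h1 h2) h3) (add_nonneg (add_nonneg h1' h2') h3')).trans (le_of_eq ?_)
  congr 1
  rw [posTrace_add _ (add_nonneg h1 h2) h3, posTrace_add _ h1 h2,
    posTrace_add _ (add_nonneg h1' h2') h3', posTrace_add _ h1' h2',
    posTrace_ofReal_smul_channel _ _ (mul_nonneg hq₁ ha),
    posTrace_ofReal_smul_channel _ _ (mul_nonneg hq₁ hc), posTrace_ofReal_smul_channel _ _ hq₂,
    posTrace_ofReal_smul_channel _ _ (mul_nonneg hq₂ ha),
    posTrace_ofReal_smul_channel _ _ (mul_nonneg hq₂ hc), posTrace_ofReal_smul_channel _ _ hq₁,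
    ← ENNReal.ofReal_add (by positivity) (by positivity),
    ← ENNReal.ofReal_add (by positivity) (by positivity),
    ← ENNReal.ofReal_add (by positivity) (by positivity),
    ← ENNReal.ofReal_add (by positivity) (by positivity),
    ← ENNReal.ofReal_add (by positivity) (by positivity)]
  congr 1
  linear_combination
    (s ^ 2 * ‖φ‖ ^ 2 + (1 + (s⁻¹) ^ 2) * ‖u‖ ^ 2 + ‖w‖ ^ 2) * hq

theorem traceNorm_delta_le {n : ℕ} {q₁ q₂ : ℝ} (hq₁ : 0 ≤ q₁) (hq₂ : 0 ≤ q₂)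
    (hq : q₁ + q₂ = 1) (γ₁ γ₂ : ℝ≥0) (ψ : Fock n) :
    traceNorm (fockBasis n) (delta n q₁ q₂ γ₁ γ₂ (rankOne ℂ ψ ψ)) ≤ ENNReal.ofReal (‖ψ‖ ^ 2) := by
  refine (traceNorm_sub_le _ (ofReal_smul_nonneg hq₁ (channel_nonneg γ₁ ψ))
    (ofReal_smul_nonneg hq₂ (channel_nonneg γ₂ ψ))).trans (le_of_eq ?_)
  rw [posTrace_ofReal_smul_channel _ _ hq₁, posTrace_ofReal_smul_channel _ _ hq₂,
    ← ENNReal.ofReal_add (by positivity) (by positivity), ← add_mul, hq, one_mul]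

theorem upperSemicontinuous_traceNorm_delta {n : ℕ} {q₁ q₂ : ℝ} (hq₁ : 0 ≤ q₁) (hq₂ : 0 ≤ q₂)
    (hq : q₁ + q₂ = 1) (γ₁ γ₂ : ℝ≥0) :
    UpperSemicontinuous fun ψ : Fock n =>
      traceNorm (fockBasis n) (delta n q₁ q₂ γ₁ γ₂ (rankOne ℂ ψ ψ)) := by
  intro φ y hy
  obtain ⟨r, hr, hry⟩ := ENNReal.lt_iff_exists_add_pos_lt.1 hy
  have hr' : (0 : ℝ) < r := hr
  -- For fixed `s` the perturbation bound tends to `2 s² ‖φ‖²` as `ψ → φ`, so `s` is chosen first.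
  obtain ⟨s, hs, hsr⟩ : ∃ s : ℝ, 0 < s ∧ s ^ 2 * ‖φ‖ ^ 2 + s ^ 2 * ‖φ‖ ^ 2 < r := by
    refine ⟨√(r / (2 * (‖φ‖ ^ 2 + 1))), Real.sqrt_pos.2 (by positivity), ?_⟩
    rw [Real.sq_sqrt (by positivity), ← two_mul, div_mul_eq_mul_div, ← mul_div_assoc,
      div_lt_iff₀ (by positivity)]
    nlinarith
  have hcont : Continuous fun ψ : Fock n => s ^ 2 * ‖φ‖ ^ 2 + (1 + (s⁻¹) ^ 2) * ‖ψ - φ‖ ^ 2 +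
      ‖(s : ℂ) • φ - ((s⁻¹ : ℝ) : ℂ) • (ψ - φ)‖ ^ 2 := by fun_prop
  have hev := hcont.tendsto φ |>.eventually_lt_const (u := (r : ℝ)) (by
    rw [sub_self, smul_zero, sub_zero, norm_zero, norm_smul, mul_pow]
    simpa using hsr)
  filter_upwards [hev] with ψ hψ
  have h := traceNorm_delta_perturbation_le hq₁ hq₂ hq γ₁ γ₂ φ (ψ - φ) hs.ne'
  rw [add_sub_cancel] at h
  refine h.trans_lt (lt_of_le_of_lt ?_ hry)
  gcongr
  rw [← ENNReal.ofReal_coe_nnreal]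
  exact ENNReal.ofReal_le_ofReal hψ.le

/-- The unit vectors of mean total photon number at most `R`. -/
def boundedEnergySphere (n : ℕ) (R : ℝ) : Set (Fock n) :=
  {ψ | ‖ψ‖ = 1 ∧ energy (rankOne ℂ ψ ψ) ≤ ENNReal.ofReal R}

/-- The energy is a supremum of continuous finite partial sums, hence lower semicontinuous. -/
theorem isClosed_boundedEnergySphere (n : ℕ) (R : ℝ) : IsClosed (boundedEnergySphere n R) := by
  refine (isClosed_eq continuous_norm continuous_const).inter ?_
  have h : {ψ : Fock n | energy (rankOne ℂ ψ ψ) ≤ ENNReal.ofReal R} =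
      ⋂ s : Finset (Fin n → ℕ), {ψ : Fock n | ∑ m ∈ s, ((∑ k, m k : ℕ) : ℝ≥0∞) *
        ENNReal.ofReal (‖⟪fockBasis n m, ψ⟫_ℂ‖ ^ 2) ≤ ENNReal.ofReal R} := by
    ext ψ
    simp only [Set.mem_ofPred_eq, Set.mem_iInter, energy_rankOne, ENNReal.tsum_eq_iSup_sum,
      iSup_le_iff]
  change IsClosed {ψ : Fock n | energy (rankOne ℂ ψ ψ) ≤ ENNReal.ofReal R}
  rw [h]
  refine isClosed_iInter fun s => isClosed_le (continuous_finsetSum _ fun m _ => ?_)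
    continuous_const
  refine (ENNReal.continuous_const_mul (ENNReal.natCast_ne_top _)).comp
    (ENNReal.continuous_ofReal.comp ?_)
  fun_prop

/-- Markov's inequality: outside the box some mode holds at least `N` photons, so the total number
there is at least `N`. -/
theorem norm_sub_truncation_sq_le {n : ℕ} {R : ℝ} (hR : 0 ≤ R) {ψ : Fock n}
    (hψ : ψ ∈ boundedEnergySphere n R) (N : ℕ) :
    N * ‖ψ - ∑ m ∈ Fintype.piFinset fun _ : Fin n => Finset.range N,
      ⟪fockBasis n m, ψ⟫_ℂ • fockBasis n m‖ ^ 2 ≤ R := by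
  set F := Fintype.piFinset fun _ : Fin n => Finset.range N with hF
  rw [← ENNReal.ofReal_le_ofReal_iff hR, ENNReal.ofReal_mul (by positivity),
    ← tsum_ofReal_norm_inner_sq (fockBasis n), ← ENNReal.tsum_mul_left]
  refine le_trans (ENNReal.tsum_le_tsum fun m => ?_) ((energy_rankOne ψ).symm.le.trans hψ.2)
  have hc : ⟪fockBasis n m, ψ - ∑ m ∈ F, ⟪fockBasis n m, ψ⟫_ℂ • fockBasis n m⟫_ℂ =
      if m ∈ F then 0 else ⟪fockBasis n m, ψ⟫_ℂ := by
    simp only [inner_sub_right, inner_sum, inner_smul_right, inner_fockBasis_fockBasis, mul_ite,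
      mul_one, mul_zero, Finset.sum_ite_eq]
    split_ifs <;> simp
  rw [hc]
  split_ifs with hm
  · simp
  · rw [ENNReal.ofReal_natCast]
    gcongr
    simp only [hF, Fintype.mem_piFinset, Finset.mem_range, not_forall, not_lt] at hm
    obtain ⟨k, hk⟩ := hm
    exact hk.trans (Finset.single_le_sum (f := m) (fun _ _ => Nat.zero_le _) (Finset.mem_univ k))

/-- Truncation costs less than `ε / 2` uniformly on the set, and the truncated vectors lie in the
image of a compact finite-dimensional ball. -/
theorem isCompact_boundedEnergySphere (n : ℕ) {R : ℝ} (hR : 0 ≤ R) :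
    IsCompact (boundedEnergySphere n R) := by
  refine TotallyBounded.isCompact_of_isClosed (Metric.totallyBounded_iff.2 fun ε hε => ?_)
    (isClosed_boundedEnergySphere n R)
  obtain ⟨N, hN⟩ := exists_nat_gt (R / (ε / 2) ^ 2)
  rw [div_lt_iff₀ (by positivity)] at hN
  set F := Fintype.piFinset fun _ : Fin n => Finset.range N with hF
  let T : (F → ℂ) → Fock n := fun c => ∑ m, c m • fockBasis n m
  have hT : Continuous T := by fun_prop
  obtain ⟨t, ht, hcov⟩ := Metric.totallyBounded_iff.1
    ((isCompact_closedBall (0 : F → ℂ) 1).image hT).totallyBounded (ε / 2) (by positivity)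
  refine ⟨t, ht, fun ψ hψ => ?_⟩
  have h1 : T (fun m => ⟪fockBasis n m, ψ⟫_ℂ) ∈ T '' Metric.closedBall (0 : F → ℂ) 1 := by
    refine Set.mem_image_of_mem T ?_
    rw [mem_closedBall_zero_iff, pi_norm_le_iff_of_nonneg zero_le_one]
    intro m
    refine (norm_inner_le_norm _ _).trans ?_
    rw [(fockBasis n).orthonormal.1, hψ.1, mul_one]
  obtain ⟨y, hy, hyψ⟩ := Set.mem_iUnion₂.1 (hcov h1)
  have h2 := norm_sub_truncation_sq_le hR hψ N
  rw [← hF, ← Finset.sum_coe_sort F] at h2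
  have h3 : ‖ψ - T (fun m => ⟪fockBasis n m, ψ⟫_ℂ)‖ < ε / 2 := by
    by_contra! h
    have h4 := pow_le_pow_left₀ (by positivity) h 2
    have h5 := mul_le_mul_of_nonneg_left h4 (Nat.cast_nonneg (α := ℝ) N)
    exact absurd (h5.trans h2) (not_le.2 hN)
  refine Set.mem_iUnion₂.2 ⟨y, hy, ?_⟩
  rw [Metric.mem_ball] at hyψ ⊢
  refine (dist_triangle _ (T fun m => ⟪fockBasis n m, ψ⟫_ℂ) _).trans_lt ?_
  rw [dist_eq_norm]
  linarith

theorem fockBasis_zero_mem_boundedEnergySphere (n : ℕ) (R : ℝ) :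
    fockBasis n 0 ∈ boundedEnergySphere n R := by
  refine ⟨(fockBasis n).orthonormal.1 0, ?_⟩
  rw [energy_rankOne]
  refine le_of_eq_of_le (ENNReal.tsum_eq_zero.2 fun m => ?_) zero_le
  rw [inner_fockBasis_fockBasis]
  split_ifs with h
  · simp [h]
  · simp

theorem admissible_eq_image (n : ℕ) (E : ℝ) :
    admissible n E = (fun ψ : Fock n => rankOne ℂ ψ ψ) '' boundedEnergySphere n (n * E) := by
  ext ρ
  constructor
  · rintro ⟨⟨ψ, hψ, rfl⟩, h⟩
    exact ⟨ψ, ⟨hψ, h⟩, rfl⟩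
  · rintro ⟨ψ, ⟨hψ, h⟩, rfl⟩
    exact ⟨⟨ψ, hψ, rfl⟩, h⟩

theorem exists_isGreatest_traceNorm_delta (n : ℕ) {q₁ q₂ : ℝ} (hq₁ : 0 ≤ q₁) (hq₂ : 0 ≤ q₂)
    (hq : q₁ + q₂ = 1) (γ₁ γ₂ : ℝ≥0) {E : ℝ} (hE : 0 ≤ E) :
    ∃ D : ℝ≥0, IsGreatest ((fun ρ => traceNorm (fockBasis n) (delta n q₁ q₂ γ₁ γ₂ ρ)) ''
      admissible n E) (D : ℝ≥0∞) := by
  obtain ⟨ψ, hψ, hmax⟩ := ((upperSemicontinuous_traceNorm_delta hq₁ hq₂ hq γ₁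
    γ₂).upperSemicontinuousOn (boundedEnergySphere n (n * E))).exists_isMaxOn
    ⟨_, fockBasis_zero_mem_boundedEnergySphere n _⟩
    (isCompact_boundedEnergySphere n (by positivity))
  have hfin : traceNorm (fockBasis n) (delta n q₁ q₂ γ₁ γ₂ (rankOne ℂ ψ ψ)) ≠ ⊤ :=
    ((traceNorm_delta_le hq₁ hq₂ hq γ₁ γ₂ ψ).trans_lt ENNReal.ofReal_lt_top).ne
  refine ⟨(traceNorm (fockBasis n) (delta n q₁ q₂ γ₁ γ₂ (rankOne ℂ ψ ψ))).toNNReal, ?_⟩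
  rw [ENNReal.coe_toNNReal hfin, admissible_eq_image, Set.image_image]
  exact ⟨Set.mem_image_of_mem _ hψ, by rintro _ ⟨φ, hφ, rfl⟩; exact hmax hφ⟩

end Maximum

/-! ### Operators supported on finitely many Fock states -/

section Compression

set_option linter.unusedSectionVars false

open InnerProductSpace Matrix
open scoped ComplexOrder

variable {κ : Type*} [Fintype κ] [DecidableEq κ] {n : ℕ}

/-- The standard basis of a finite-dimensional Euclidean space. -/
noncomputable abbrev stdBasis (κ : Type*) [Fintype κ] [DecidableEq κ] :
    HilbertBasis κ ℂ (EuclideanSpace ℂ κ) :=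
  (EuclideanSpace.basisFun κ ℂ).toHilbertBasis

theorem exists_isometry_fockBasis {σ : κ → Fin n → ℕ} (hσ : Function.Injective σ) :
    ∃ V : EuclideanSpace ℂ κ →L[ℂ] Fock n, ‖V‖ ≤ 1 ∧ ContinuousLinearMap.adjoint V ∘L V = 1 ∧
      (∀ j, V (stdBasis κ j) = fockBasis n (σ j)) ∧
      ∀ j, ContinuousLinearMap.adjoint V (fockBasis n (σ j)) = stdBasis κ j := by
  let f : EuclideanSpace ℂ κ →ₗ[ℂ] Fock n :=
    (EuclideanSpace.basisFun κ ℂ).toBasis.constr ℂ fun j => fockBasis n (σ j)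
  have hf : ∀ j, f ((EuclideanSpace.basisFun κ ℂ).toBasis j) = fockBasis n (σ j) := fun j =>
    Module.Basis.constr_basis _ _ _ _
  let W : EuclideanSpace ℂ κ →ₗᵢ[ℂ] Fock n := f.isometryOfOrthonormal
    (v := (EuclideanSpace.basisFun κ ℂ).toBasis)
    (by rw [OrthonormalBasis.coe_toBasis]; exact (EuclideanSpace.basisFun κ ℂ).orthonormal)
    (by
      have : f ∘ (EuclideanSpace.basisFun κ ℂ).toBasis = fun j => fockBasis n (σ j) := funext hf
      rw [this]
      exact (fockBasis n).orthonormal.comp σ hσ)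
  have hW : ∀ j, W (stdBasis κ j) = fockBasis n (σ j) := fun j => by
    have := hf j
    rw [OrthonormalBasis.coe_toBasis] at this
    rw [stdBasis, OrthonormalBasis.coe_toHilbertBasis]
    exact this
  have hWW : ContinuousLinearMap.adjoint W.toContinuousLinearMap ∘L W.toContinuousLinearMap = 1 := by
    ext1 x
    refine ext_inner_left ℂ fun y => ?_
    rw [ContinuousLinearMap.comp_apply, ContinuousLinearMap.adjoint_inner_right]
    exact W.inner_map_map y x
  refine ⟨W.toContinuousLinearMap, W.norm_toContinuousLinearMap_le, hWW, hW, fun j => ?_⟩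
  rw [← hW]
  exact DFunLike.congr_fun hWW (stdBasis κ j)

theorem compression_eq {σ : κ → Fin n → ℕ} {V : EuclideanSpace ℂ κ →L[ℂ] Fock n}
    (hV : ∀ j, V (stdBasis κ j) = fockBasis n (σ j)) {A : Fock n →L[ℂ] Fock n}
    {S : Matrix κ κ ℂ} (hS : ∀ i j, ⟪fockBasis n (σ i), A (fockBasis n (σ j))⟫_ℂ = S i j) :
    ContinuousLinearMap.adjoint V ∘L A ∘L V = toEuclideanCLM (𝕜 := ℂ) S := by
  refine hilbertBasis_op_ext (stdBasis κ) fun i j => ?_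
  rw [inner_toEuclideanCLM_basis, ContinuousLinearMap.comp_apply,
    ContinuousLinearMap.adjoint_inner_right, ContinuousLinearMap.comp_apply, hV, hV, hS]

theorem posSemidef_of_compression {σ : κ → Fin n → ℕ} (hσ : Function.Injective σ)
    {A : Fock n →L[ℂ] Fock n} (hA : 0 ≤ A) {S : Matrix κ κ ℂ}
    (hS : ∀ i j, ⟪fockBasis n (σ i), A (fockBasis n (σ j))⟫_ℂ = S i j) : S.PosSemidef := by
  obtain ⟨V, -, -, hV, -⟩ := exists_isometry_fockBasis hσ
  have h := ((ContinuousLinearMap.nonneg_iff_isPositive A).1 hA).adjoint_conj V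
  rw [compression_eq hV hS] at h
  rw [← Matrix.isPositive_toEuclideanLin_iff, ← coe_toEuclideanCLM_eq_toEuclideanLin]
  exact (ContinuousLinearMap.isPositive_toLinearMap_iff _).2 h

/-- `C` kills the Fock states outside the range of `σ`, so the infinite trace collapses to a finite
sum. -/
theorem opTrace_mul_eq_sum {σ : κ → Fin n → ℕ} (hσ : Function.Injective σ)
    (B : Fock n →L[ℂ] Fock n) {C : Fock n →L[ℂ] Fock n}
    (hC : ∀ j ∉ Set.range σ, C (fockBasis n j) = 0) :
    opTrace (fockBasis n) (B * C) =
      ∑ j, ⟪fockBasis n (σ j), B (C (fockBasis n (σ j)))⟫_ℂ := by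
  rw [opTrace, ← tsum_fintype (L := .unconditional κ)]
  refine (hσ.tsum_eq fun j hj => ?_).symm
  by_contra h
  refine hj ?_
  beta_reduce
  rw [mul_apply_eq_comp, hC j h, map_zero, inner_zero_right]

theorem isStarProjection_toEuclideanCLM {q : Matrix κ κ ℂ} (hq : q.IsHermitian)
    (hqq : q * q = q) : IsStarProjection (toEuclideanCLM (𝕜 := ℂ) q) := by
  refine ⟨?_, ?_⟩
  · rw [IsIdempotentElem, ← map_mul, hqq]
  · rw [IsSelfAdjoint, ← map_star, star_eq_conjTranspose, hq.eq]

/-- The projection onto Fock states corresponding to a finite projection matrix. -/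
theorem exists_projection_opTrace {σ : κ → Fin n → ℕ} (hσ : Function.Injective σ)
    {q : Matrix κ κ ℂ} (hq : q.IsHermitian) (hqq : q * q = q) :
    ∃ Q : Fock n →L[ℂ] Fock n, 0 ≤ Q ∧ Q ≤ 1 ∧
      ∀ (C : Fock n →L[ℂ] Fock n) (S : Matrix κ κ ℂ),
        (∀ i j, ⟪fockBasis n (σ i), C (fockBasis n (σ j))⟫_ℂ = S i j) →
        (∀ j ∉ Set.range σ, C (fockBasis n j) = 0) →
        opTrace (fockBasis n) (Q * C) = (q * S).trace ∧
        opTrace (fockBasis n) ((1 - Q) * C) = S.trace - (q * S).trace := by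
  obtain ⟨V, -, hVV, hV, hV'⟩ := exists_isometry_fockBasis hσ
  have hp := isStarProjection_toEuclideanCLM hq hqq
  set p := toEuclideanCLM (𝕜 := ℂ) q with hp_def
  -- The test is `q` transported along the isometry `V`.
  have hQ : IsStarProjection (V ∘L p ∘L ContinuousLinearMap.adjoint V) := by
    refine ⟨?_, ?_⟩
    · ext1 x
      have h1 : ∀ y, ContinuousLinearMap.adjoint V (V y) = y := fun y => DFunLike.congr_fun hVV y
      have h2 : ∀ y, p (p y) = p y := fun y => DFunLike.congr_fun hp.isIdempotentElem y
      simp only [mul_apply_eq_comp, ContinuousLinearMap.comp_apply, h1, h2]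
    · rw [ContinuousLinearMap.isSelfAdjoint_iff', ContinuousLinearMap.adjoint_comp,
        ContinuousLinearMap.adjoint_comp, ContinuousLinearMap.adjoint_adjoint,
        ContinuousLinearMap.isSelfAdjoint_iff'.1 hp.isSelfAdjoint, ContinuousLinearMap.comp_assoc]
  refine ⟨_, hQ.nonneg, hQ.le_one, fun C S hS hC => ?_⟩
  have h1 : ∑ j, ⟪fockBasis n (σ j), (V ∘L p ∘L ContinuousLinearMap.adjoint V)
      (C (fockBasis n (σ j)))⟫_ℂ = (q * S).trace := by
    have hc := compression_eq hV hS
    refine Finset.sum_congr rfl fun j _ => ?_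
    rw [ContinuousLinearMap.comp_apply, ← ContinuousLinearMap.adjoint_inner_left, hV',
      ContinuousLinearMap.comp_apply, diag_apply, ← inner_toEuclideanCLM_basis (q * S), map_mul,
      ← hc, ← hV j]
    rfl
  refine ⟨by rw [opTrace_mul_eq_sum hσ _ hC, h1], ?_⟩
  rw [opTrace_mul_eq_sum hσ _ hC]
  simp only [_root_.sub_apply, inner_sub_right, Finset.sum_sub_distrib, h1]
  congr 1
  exact Finset.sum_congr rfl fun j _ => hS j j

theorem trace_test_le_traceNorm {σ : κ → Fin n → ℕ} (hσ : Function.Injective σ)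
    {q : Matrix κ κ ℂ} (hq : q.IsHermitian) (hqq : q * q = q)
    {A : Fock n →L[ℂ] Fock n} (hA : IsSelfAdjoint A) {S : Matrix κ κ ℂ}
    (hS : ∀ i j, ⟪fockBasis n (σ i), A (fockBasis n (σ j))⟫_ℂ = S i j) :
    ENNReal.ofReal (2 * (q * S).trace.re - S.trace.re) ≤ traceNorm (fockBasis n) A := by
  obtain ⟨V, hV1, -, hV, -⟩ := exists_isometry_fockBasis hσ
  have hc := compression_eq hV hS
  have norm_le : ∀ {p : Matrix κ κ ℂ}, p.IsHermitian → p * p = p →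
      ‖V ∘L toEuclideanCLM (𝕜 := ℂ) p‖ ≤ 1 := fun hp hpp =>
    (ContinuousLinearMap.opNorm_comp_le _ _).trans
      (mul_le_one₀ hV1 (norm_nonneg _) (isStarProjection_toEuclideanCLM hp hpp).norm_le)
  have sum_eq : ∀ {p : Matrix κ κ ℂ}, p.IsHermitian → p * p = p →
      ∑ j, (⟪(V ∘L toEuclideanCLM (𝕜 := ℂ) p) (stdBasis κ j),
        A ((V ∘L toEuclideanCLM (𝕜 := ℂ) p) (stdBasis κ j))⟫_ℂ).re = (p * S).trace.re := by
    intro p hp hpp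
    have hps := (isStarProjection_toEuclideanCLM hp hpp).isSelfAdjoint
    have h1 : (p * S).trace = (p * S * p).trace := by
      rw [trace_mul_comm (p * S) p, ← mul_assoc, hpp]
    rw [h1, trace, Complex.re_sum]
    refine Finset.sum_congr rfl fun j _ => ?_
    rw [ContinuousLinearMap.comp_apply, ← ContinuousLinearMap.adjoint_inner_right,
      ← ContinuousLinearMap.adjoint_inner_right, ContinuousLinearMap.isSelfAdjoint_iff'.1 hps,
      diag_apply, ← inner_toEuclideanCLM_basis (p * S * p), map_mul, map_mul, ← hc]
    rfl
  have hq' : (1 - q).IsHermitian := isHermitian_one.sub hq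
  have hqq' : (1 - q) * (1 - q) = 1 - q := by
    rw [mul_sub, sub_mul, sub_mul, hqq]; simp
  -- Test with `V q` and `V (1 - q)`; the difference of the two traces is `Tr ((2q - 1) S)`.
  have h := sum_compression_sub_le_traceNorm (fockBasis n) (stdBasis κ) (norm_le hq hqq)
    (norm_le hq' hqq') hA
  rw [sum_eq hq hqq, sum_eq hq' hqq'] at h
  refine le_of_eq_of_le ?_ h
  congr 1
  rw [sub_mul, one_mul, trace_sub, Complex.sub_re]
  ring

end Compression

/-! ### Product inputs with finitely many levels -/

section Product

open InnerProductSpace Matrix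
open scoped ComplexOrder

/-! ### Finite superpositions of Fock states -/

section PureVector

variable {κ : Type*} [Fintype κ] {n : ℕ}

/-- The vector `∑ j, c j |σ j⟩`. -/
noncomputable def pureVector (σ : κ → Fin n → ℕ) (c : κ → ℂ) : Fock n :=
  ∑ j, c j • fockBasis n (σ j)

theorem inner_fockBasis_pureVector {σ : κ → Fin n → ℕ} (hσ : Function.Injective σ) (c : κ → ℂ)
    (j : κ) : ⟪fockBasis n (σ j), pureVector σ c⟫_ℂ = c j := by
  classical
  simp [pureVector, inner_fockBasis_fockBasis, hσ.eq_iff]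

theorem inner_fockBasis_pureVector_of_notMem {σ : κ → Fin n → ℕ} (c : κ → ℂ) {i : Fin n → ℕ}
    (hi : i ∉ Set.range σ) : ⟪fockBasis n i, pureVector σ c⟫_ℂ = 0 := by
  rw [pureVector, inner_sum]
  refine Finset.sum_eq_zero fun j _ => ?_
  rw [inner_smul_right, inner_fockBasis_fockBasis, if_neg fun h => hi ⟨j, h.symm⟩, mul_zero]

theorem tsum_pureVector {σ : κ → Fin n → ℕ} (hσ : Function.Injective σ) (c : κ → ℂ)
    (w : (Fin n → ℕ) → ℝ≥0∞) :
    ∑' m, w m * ENNReal.ofReal (‖⟪fockBasis n m, pureVector σ c⟫_ℂ‖ ^ 2) =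
      ∑ j, w (σ j) * ENNReal.ofReal (‖c j‖ ^ 2) := by
  rw [← tsum_fintype (L := .unconditional κ), ← hσ.tsum_eq]
  · simp_rw [inner_fockBasis_pureVector hσ]
  · intro m hm
    by_contra h
    refine hm ?_
    simp [inner_fockBasis_pureVector_of_notMem c h]

theorem norm_pureVector_sq {σ : κ → Fin n → ℕ} (hσ : Function.Injective σ) (c : κ → ℂ) :
    ‖pureVector σ c‖ ^ 2 = ∑ j, ‖c j‖ ^ 2 := by
  have h := tsum_pureVector hσ c fun _ => 1
  simp only [one_mul] at h
  rw [tsum_ofReal_norm_inner_sq, ← ENNReal.ofReal_sum_of_nonneg fun _ _ => sq_nonneg _,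
    ENNReal.ofReal_eq_ofReal_iff (sq_nonneg _) (Finset.sum_nonneg fun _ _ => sq_nonneg _)] at h
  exact h

theorem energy_pureVector {σ : κ → Fin n → ℕ} (hσ : Function.Injective σ) (c : κ → ℂ) :
    energy (rankOne ℂ (pureVector σ c) (pureVector σ c)) =
      ENNReal.ofReal (∑ j, ((∑ k, σ j k : ℕ) : ℝ) * ‖c j‖ ^ 2) := by
  rw [energy_rankOne, tsum_pureVector hσ c fun m => ((∑ k, m k : ℕ) : ℝ≥0∞),
    ENNReal.ofReal_sum_of_nonneg fun _ _ => by positivity]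
  refine Finset.sum_congr rfl fun j _ => ?_
  rw [ENNReal.ofReal_mul (by positivity), ENNReal.ofReal_natCast]

theorem inner_channel_pureVector {σ : κ → Fin n → ℕ} (hσ : Function.Injective σ) (c : κ → ℂ)
    (γ : ℝ≥0) (i j : κ) :
    ⟪fockBasis n (σ i), channel n γ (rankOne ℂ (pureVector σ c) (pureVector σ c))
      (fockBasis n (σ j))⟫_ℂ = c i * (starRingEnd ℂ) (c j) * decay γ (σ i) (σ j) := by
  rw [inner_channel_fockBasis, ← inner_conj_symm (pureVector σ c),
    inner_fockBasis_pureVector hσ, inner_fockBasis_pureVector hσ]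

theorem channel_pureVector_of_notMem {σ : κ → Fin n → ℕ} (c : κ → ℂ) (γ : ℝ≥0) {j : Fin n → ℕ}
    (hj : j ∉ Set.range σ) :
    channel n γ (rankOne ℂ (pureVector σ c) (pureVector σ c)) (fockBasis n j) = 0 := by
  refine fock_ext fun i => ?_
  rw [inner_channel_fockBasis, ← inner_conj_symm (pureVector σ c),
    inner_fockBasis_pureVector_of_notMem c hj]
  simp

end PureVector

/-! ### Dephased single-mode states and their tensor powers -/

variable {d : ℕ}

/-- The density matrix, on the levels `ℓ`, of the dephased single-mode state
`∑ j, a j |ℓ j⟩`. -/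
noncomputable def outputMatrix (ℓ : Fin d → ℕ) (a : Fin d → ℝ) (γ : ℝ≥0) :
    Matrix (Fin d) (Fin d) ℂ :=
  Matrix.of fun i j =>
    ((a i * a j * Real.exp (-(γ : ℝ) / 2 * ((ℓ i : ℝ) - (ℓ j : ℝ)) ^ 2) : ℝ) : ℂ)

/-- It is a compression of a one-mode channel output, so positivity of the Gaussian kernel is
inherited from the channel. -/
theorem outputMatrix_posSemidef {ℓ : Fin d → ℕ} (hℓ : Function.Injective ℓ) (a : Fin d → ℝ)
    (γ : ℝ≥0) : (outputMatrix ℓ a γ).PosSemidef := by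
  have hσ : Function.Injective fun j => fun _ : Fin 1 => ℓ j :=
    fun i j h => hℓ (congrFun h 0)
  refine posSemidef_of_compression hσ
    (channel_nonneg γ (pureVector (fun j => fun _ : Fin 1 => ℓ j) fun j => (a j : ℂ))) fun i j => ?_
  rw [inner_channel_pureVector hσ]
  simp [outputMatrix, decay]

theorem trace_outputMatrix {ℓ : Fin d → ℕ} {a : Fin d → ℝ} (ha : ∑ j, a j ^ 2 = 1) (γ : ℝ≥0) :
    (outputMatrix ℓ a γ).trace = 1 := by
  simp only [trace, diag_apply, outputMatrix, of_apply, sub_self, ne_eq, OfNat.ofNat_ne_zero,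
    not_false_eq_true, zero_pow, mul_zero, Real.exp_zero, mul_one, ← sq]
  rw [← Complex.ofReal_sum, ha, Complex.ofReal_one]

/-- Square roots of outputs have a strictly positive overlap. -/
theorem overlap_pos {ℓ : Fin d → ℕ} {a : Fin d → ℝ} (ha : ∑ j, a j ^ 2 = 1) {γ₁ γ₂ : ℝ≥0}
    {X Y : Matrix (Fin d) (Fin d) ℂ} (hX : X.PosSemidef) (hY : Y.PosSemidef)
    (hX2 : X * X = outputMatrix ℓ a γ₁) (hY2 : Y * Y = outputMatrix ℓ a γ₂) :
    0 < (X * Y).trace.re := by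
  obtain ⟨A, hA, rfl⟩ := exists_posSemidef_sqrt hX
  obtain ⟨B, hB, rfl⟩ := exists_posSemidef_sqrt hY
  -- With `X = A²` and `Y = B²` the overlap is the squared Hilbert–Schmidt norm of `AB`. If it
  -- vanished, the product of the outputs would have trace zero, yet that trace is a sum of
  -- nonnegative terms, one of them positive.
  have h1 : (A * A * (B * B)).trace = ((A * B) * (A * B)ᴴ).trace := by
    rw [conjTranspose_mul, hA.1.eq, hB.1.eq, ← mul_assoc (A * B) B A, trace_mul_comm _ A]
    simp only [mul_assoc]
  have h2 : 0 ≤ ((A * B) * (A * B)ᴴ).trace := (posSemidef_self_mul_conjTranspose _).trace_nonneg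
  rw [h1]
  refine lt_of_le_of_ne (Complex.nonneg_iff.1 h2).1 fun h0 => ?_
  have h3 : ((A * B) * (A * B)ᴴ).trace = 0 :=
    Complex.ext h0.symm (Complex.nonneg_iff.1 h2).2.symm
  have h4 : A * B = 0 := trace_mul_conjTranspose_self_eq_zero_iff.1 h3
  have h5 : (outputMatrix ℓ a γ₁ * outputMatrix ℓ a γ₂).trace = 0 := by
    rw [← hX2, ← hY2]
    have : A * A * (A * A) * (B * B * (B * B)) = A * A * A * (A * B) * (B * B * B) := by
      simp only [mul_assoc]
    rw [this, h4]
    simp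
  have h6 : (0 : ℝ) < ∑ i, ∑ j, (a i * a j) ^ 2 *
      (Real.exp (-(γ₁ : ℝ) / 2 * ((ℓ i : ℝ) - (ℓ j : ℝ)) ^ 2) *
        Real.exp (-(γ₂ : ℝ) / 2 * ((ℓ j : ℝ) - (ℓ i : ℝ)) ^ 2)) := by
    have hne : ∃ i, a i ≠ 0 := by
      by_contra! h
      simp [h] at ha
    obtain ⟨i, hi⟩ := hne
    refine Finset.sum_pos' (fun i _ => Finset.sum_nonneg fun j _ => by positivity)
      ⟨i, Finset.mem_univ i, Finset.sum_pos' (fun j _ => by positivity)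
        ⟨i, Finset.mem_univ i, by positivity⟩⟩
  refine h6.ne' ?_
  rw [← Complex.ofReal_inj, Complex.ofReal_zero, ← h5]
  simp only [trace, diag_apply, mul_apply, outputMatrix, of_apply, Complex.ofReal_sum]
  refine Finset.sum_congr rfl fun i _ => Finset.sum_congr rfl fun j _ => ?_
  push_cast
  ring

theorem sum_prod_eq_pow (n : ℕ) (f : Fin d → ℝ) :
    ∑ m : Fin n → Fin d, ∏ k, f (m k) = (∑ j, f j) ^ n := by
  have h := Finset.prod_univ_sum (fun _ : Fin n => (Finset.univ : Finset (Fin d))) fun _ i => f i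
  rw [Finset.prod_const, Finset.card_univ, Fintype.card_fin, Fintype.piFinset_univ] at h
  exact h.symm

/-- Linearity of expectation for `n` independent draws with weights `f`; it makes the product
input's energy `n` times the single-mode energy. -/
theorem sum_mul_prod_eq (n : ℕ) (f g : Fin d → ℝ) (hf : ∑ j, f j = 1) :
    ∑ m : Fin n → Fin d, (∑ k, g (m k)) * ∏ k, f (m k) = n * ∑ j, g j * f j := by
  have h : ∀ k : Fin n, ∑ m : Fin n → Fin d, g (m k) * ∏ k', f (m k') = ∑ j, g j * f j := by
    intro k
    have h1 := Finset.prod_univ_sum (fun _ : Fin n => (Finset.univ : Finset (Fin d)))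
      fun k' i => (if k' = k then g i else 1) * f i
    rw [Fintype.piFinset_univ] at h1
    simp only [Finset.prod_mul_distrib, Finset.prod_ite_eq', Finset.mem_univ, if_true] at h1
    rw [← h1, ← Finset.mul_prod_erase _ _ (Finset.mem_univ k), Finset.prod_eq_one]
    · simp
    · intro k' hk'
      simp [Finset.ne_of_mem_erase hk', hf]
  simp_rw [Finset.sum_mul]
  rw [Finset.sum_comm]
  simp [h]

/-- A product input together with the test optimal for `√(q₁ S₁) - √(q₂ S₂)`. -/
theorem exists_admissible_test (n : ℕ) {q₁ q₂ : ℝ} (hq₁ : 0 ≤ q₁) (hq₂ : 0 ≤ q₂)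
    (hq : q₁ + q₂ = 1) (γ₁ γ₂ : ℝ≥0) {E : ℝ} {ℓ : Fin d → ℕ} (hℓ : Function.Injective ℓ)
    {a : Fin d → ℝ} (ha : ∑ j, a j ^ 2 = 1) (hE : ∑ j, (ℓ j : ℝ) * a j ^ 2 ≤ E)
    {X Y : Matrix (Fin d) (Fin d) ℂ} (hX : X.PosSemidef) (hY : Y.PosSemidef)
    (hX2 : X * X = outputMatrix ℓ a γ₁) (hY2 : Y * Y = outputMatrix ℓ a γ₂) :
    ∃ ρ ∈ admissible n E,
      ENNReal.ofReal (1 - 2 * √(q₁ * q₂) * (X * Y).trace.re ^ n) ≤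
        traceNorm (fockBasis n) (delta n q₁ q₂ γ₁ γ₂ ρ) ∧
      ∃ Q : Fock n →L[ℂ] Fock n, 0 ≤ Q ∧ Q ≤ 1 ∧
        errorProb n q₁ q₂ γ₁ γ₂ ρ Q ≤ √(q₁ * q₂) * (X * Y).trace.re ^ n := by
  let σ : (Fin n → Fin d) → Fin n → ℕ := fun m k => ℓ (m k)
  have hσ : Function.Injective σ := fun m m' h => funext fun k => hℓ (congrFun h k)
  let c : (Fin n → Fin d) → ℂ := fun m => ((∏ k, a (m k) : ℝ) : ℂ)
  have hc : ∀ m, ‖c m‖ ^ 2 = ∏ k, a (m k) ^ 2 := fun m => by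
    simp only [c, Complex.norm_real, Real.norm_eq_abs, sq_abs, Finset.prod_pow]
  set ψ := pureVector σ c with hψ
  have hψ1 : ‖ψ‖ = 1 := by
    have h : ‖ψ‖ ^ 2 = 1 := by
      rw [norm_pureVector_sq hσ]
      simp_rw [hc]
      rw [sum_prod_eq_pow n fun j => a j ^ 2, ha, one_pow]
    exact (pow_eq_one_iff_of_nonneg (norm_nonneg _) two_ne_zero).1 h
  have hadm : rankOne ℂ ψ ψ ∈ admissible n E := by
    refine ⟨⟨ψ, hψ1, rfl⟩, ?_⟩
    rw [energy_pureVector hσ]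
    refine ENNReal.ofReal_le_ofReal ?_
    simp_rw [hc]
    have := sum_mul_prod_eq n (fun j => a j ^ 2) (fun j => (ℓ j : ℝ)) ha
    simp only [σ, Nat.cast_sum]
    rw [this]
    gcongr
  have hS : ∀ γ i j, ⟪fockBasis n (σ i), channel n γ (rankOne ℂ ψ ψ) (fockBasis n (σ j))⟫_ℂ =
      tensorPow n (outputMatrix ℓ a γ) i j := fun γ i j => by
    rw [inner_channel_pureVector hσ]
    simp only [c, Complex.conj_ofReal, tensorPow, outputMatrix, of_apply, decay, σ]
    rw [← Complex.ofReal_prod, ← Complex.ofReal_mul, ← Complex.ofReal_mul,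
      Finset.prod_mul_distrib, Finset.prod_mul_distrib]
  have hC : ∀ γ, ∀ j ∉ Set.range σ, channel n γ (rankOne ℂ ψ ψ) (fockBasis n j) = 0 :=
    fun γ j hj => channel_pureVector_of_notMem c γ hj
  set S₁ := tensorPow n (outputMatrix ℓ a γ₁) with hS₁
  set S₂ := tensorPow n (outputMatrix ℓ a γ₂) with hS₂
  have htr : ∀ γ, (tensorPow n (outputMatrix ℓ a γ)).trace = 1 := fun γ => by
    rw [trace_tensorPow, trace_outputMatrix ha, one_pow]
  have smul_psd : ∀ {q : ℝ} {Z : Matrix (Fin d) (Fin d) ℂ}, Z.PosSemidef →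
      (((√q : ℝ) : ℂ) • tensorPow n Z).PosSemidef := fun hZ =>
    (tensorPow_posSemidef n hZ).smul (Complex.zero_le_real.2 (Real.sqrt_nonneg _))
  have smul_sq : ∀ {q : ℝ} (_ : 0 ≤ q) (Z : Matrix (Fin d) (Fin d) ℂ),
      (((√q : ℝ) : ℂ) • tensorPow n Z) * (((√q : ℝ) : ℂ) • tensorPow n Z) =
        (q : ℂ) • tensorPow n (Z * Z) := fun hq Z => by
    rw [smul_mul_smul_comm, tensorPow_mul, ← Complex.ofReal_mul, Real.mul_self_sqrt hq]
  obtain ⟨q, hqh, hqq, hps⟩ := exists_projection_powers_stormer (smul_psd (q := q₁) hX)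
    (smul_psd (q := q₂) hY)
  set τ := (X * Y).trace.re with hτ
  have hτc : (X * Y).trace = (τ : ℂ) := by
    refine Complex.ext rfl ?_
    have : (starRingEnd ℂ) (X * Y).trace = (X * Y).trace := by
      change star (X * Y).trace = _
      rw [← trace_conjTranspose, conjTranspose_mul, hX.1.eq, hY.1.eq, trace_mul_comm]
    rw [Complex.ofReal_im]
    exact Complex.conj_eq_iff_im.1 this
  -- The squares contribute `q₁ + q₂ = 1`; the cross terms factor over the copies.
  have hcross : ((((√q₁ : ℝ) : ℂ) • tensorPow n X - ((√q₂ : ℝ) : ℂ) • tensorPow n Y) *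
      (((√q₁ : ℝ) : ℂ) • tensorPow n X - ((√q₂ : ℝ) : ℂ) • tensorPow n Y)).trace =
      ((1 - 2 * √(q₁ * q₂) * τ ^ n : ℝ) : ℂ) := by
    rw [mul_sub, sub_mul, sub_mul, smul_sq hq₁, smul_sq hq₂, hX2, hY2, smul_mul_smul_comm,
      smul_mul_smul_comm, tensorPow_mul, tensorPow_mul]
    simp only [trace_sub, trace_smul, htr, trace_tensorPow, trace_mul_comm Y X, hτc, smul_eq_mul]
    rw [Real.sqrt_mul hq₁]
    have : (q₁ : ℂ) + q₂ = 1 := by exact_mod_cast hq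
    push_cast
    linear_combination this
  rw [hcross, Complex.ofReal_re, smul_sq hq₁, smul_sq hq₂, hX2, hY2, ← hS₁, ← hS₂] at hps
  have htrA : ((q₁ : ℂ) • S₁ - (q₂ : ℂ) • S₂).trace = ((q₁ - q₂ : ℝ) : ℂ) := by
    rw [trace_sub, trace_smul, trace_smul, htr, htr]
    simp
  have hdelta : ∀ i j, ⟪fockBasis n (σ i), delta n q₁ q₂ γ₁ γ₂ (rankOne ℂ ψ ψ)
      (fockBasis n (σ j))⟫_ℂ = ((q₁ : ℂ) • S₁ - (q₂ : ℂ) • S₂) i j := fun i j => by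
    simp only [delta, _root_.sub_apply, _root_.smul_apply, inner_sub_right, inner_smul_right, hS,
      Matrix.sub_apply, Matrix.smul_apply, smul_eq_mul, hS₁, hS₂]
  refine ⟨_, hadm, ?_, ?_⟩
  · exact (ENNReal.ofReal_le_ofReal hps).trans
      (trace_test_le_traceNorm hσ hqh hqq (delta_isSelfAdjoint q₁ q₂ γ₁ γ₂ ψ) hdelta)
  -- The error is `q₁ - Tr (q (q₁ S₁ - q₂ S₂))`, and `q₁ + q₂ = 1` turns the Powers–Størmer bound
  -- into the claim.
  · obtain ⟨Q, hQ0, hQ1, hQ⟩ := exists_projection_opTrace hσ hqh hqq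
    refine ⟨Q, hQ0, hQ1, ?_⟩
    rw [errorProb, (hQ _ _ (hS γ₁) (hC γ₁)).2, (hQ _ _ (hS γ₂) (hC γ₂)).1, htr]
    rw [htrA, Complex.ofReal_re, mul_sub, mul_smul_comm, mul_smul_comm, trace_sub, trace_smul, trace_smul,
      Complex.sub_re, smul_eq_mul, smul_eq_mul, Complex.re_ofReal_mul, Complex.re_ofReal_mul] at hps
    rw [Complex.sub_re, Complex.one_re]
    linarith

theorem matrixTraceNorm_smul {M : ℕ} {c : ℝ} (hc : 0 ≤ c) (A : Matrix (Fin M) (Fin M) ℂ) :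
    matrixTraceNorm ((c : ℂ) • A) = c * matrixTraceNorm A := by
  rw [matrixTraceNorm, map_smul, traceNorm_smul _ hc, ENNReal.toReal_mul, ENNReal.toReal_ofReal hc]
  rfl

/-- The bounds attained by the product input `(∑ j, a j |ℓ j⟩)^⊗n`. -/
theorem product_input_bounds (n : ℕ) {q₁ q₂ : ℝ} (hq₁ : 0 ≤ q₁) (hq₂ : 0 ≤ q₂)
    (hq : q₁ + q₂ = 1) (γ₁ γ₂ : ℝ≥0) {E : ℝ} {ℓ : Fin d → ℕ} (hℓ : Function.Injective ℓ)
    {a : Fin d → ℝ} (ha : ∑ j, a j ^ 2 = 1) (hE : ∑ j, (ℓ j : ℝ) * a j ^ 2 ≤ E) {α : ℝ}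
    (hα : α = matrixTraceNorm (outputMatrix ℓ a γ₁ - outputMatrix ℓ a γ₂) ^ 2 / 4) :
    α < 1 ∧ ∃ ρ ∈ admissible n E,
      ENNReal.ofReal (1 - 2 * √(q₁ * q₂) * (1 - α) ^ ((n : ℝ) / 2)) ≤
        traceNorm (fockBasis n) (delta n q₁ q₂ γ₁ γ₂ ρ) ∧
      ∃ Q : Fock n →L[ℂ] Fock n, 0 ≤ Q ∧ Q ≤ 1 ∧
        errorProb n q₁ q₂ γ₁ γ₂ ρ Q ≤ 1 / 2 * Real.exp (n * Real.log √(1 - α)) := by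
  obtain ⟨X, hX, hX2⟩ := exists_posSemidef_sqrt (outputMatrix_posSemidef hℓ a γ₁)
  obtain ⟨Y, hY, hY2⟩ := exists_posSemidef_sqrt (outputMatrix_posSemidef hℓ a γ₂)
  have hτ := overlap_pos ha hX hY hX2 hY2
  have hold := matrixTraceNorm_sq_sub_sq_le hX.1 hY.1
  have hsub : ((X - Y) * (X - Y)).trace.re = 2 - 2 * (X * Y).trace.re := by
    rw [mul_sub, sub_mul, sub_mul, hX2, hY2]
    simp only [trace_sub, trace_outputMatrix ha, trace_mul_comm Y X, Complex.sub_re, Complex.one_re]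
    ring
  have hadd : ((X + Y) * (X + Y)).trace.re = 2 + 2 * (X * Y).trace.re := by
    rw [mul_add, add_mul, add_mul, hX2, hY2]
    simp only [trace_add, trace_outputMatrix ha, trace_mul_comm Y X, Complex.add_re, Complex.one_re]
    ring
  rw [hsub, hadd, hX2, hY2] at hold
  set τ := (X * Y).trace.re
  have hτα : τ ^ 2 ≤ 1 - α := by rw [hα]; linarith
  -- Strict positivity of `τ` gives `α < 1`, so the power and the logarithm below have a positive
  -- argument.
  have hα1 : 0 < 1 - α := lt_of_lt_of_le (by positivity) hτα
  have hτs : τ ^ n ≤ √(1 - α) ^ n :=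
    pow_le_pow_left₀ hτ.le (Real.le_sqrt_of_sq_le hτα) n
  obtain ⟨ρ, hρ, hD, Q, hQ0, hQ1, hQ⟩ :=
    exists_admissible_test n hq₁ hq₂ hq γ₁ γ₂ hℓ ha hE hX hY hX2 hY2
  refine ⟨by linarith, ρ, hρ, le_trans (ENNReal.ofReal_le_ofReal ?_) hD, Q, hQ0, hQ1,
    hQ.trans ?_⟩
  · have : (1 - α) ^ ((n : ℝ) / 2) = √(1 - α) ^ n := by
      rw [Real.sqrt_eq_rpow, ← Real.rpow_natCast, ← Real.rpow_mul hα1.le]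
      congr 1
      ring
    rw [this]
    gcongr
  · rw [← Real.log_pow, Real.exp_log (by positivity)]
    refine mul_le_mul ?_ hτs (by positivity) (by norm_num)
    refine Real.sqrt_le_iff.2 ⟨by norm_num, ?_⟩
    nlinarith [sq_nonneg (q₁ - q₂)]

end Product

/-! ### The uniform and the two-level inputs -/

section Inputs

open Matrix

theorem outputMatrix_isHermitian {d : ℕ} (ℓ : Fin d → ℕ) (a : Fin d → ℝ) (γ : ℝ≥0) :
    (outputMatrix ℓ a γ).IsHermitian := by
  ext i j
  simp only [conjTranspose_apply, outputMatrix, of_apply, RCLike.star_def, Complex.conj_ofReal]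
  congr 1
  rw [mul_comm (a j), ← neg_sub (ℓ i : ℝ), neg_sq]

theorem exp_decay_ne {γ₁ γ₂ : ℝ≥0} (h : γ₁ ≠ γ₂) {x : ℝ} (hx : x ≠ 0) :
    Real.exp (-(γ₁ : ℝ) / 2 * x ^ 2) ≠ Real.exp (-(γ₂ : ℝ) / 2 * x ^ 2) := by
  intro he
  have h1 := mul_right_cancel₀ (pow_ne_zero 2 hx) (Real.exp_injective he)
  exact h (NNReal.coe_injective (by linarith))

theorem outputMatrix_uniform_sub (M : ℕ) (γ₁ γ₂ : ℝ≥0) :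
    outputMatrix (fun j : Fin M => (j : ℕ)) (fun _ => √(1 / M)) γ₁ -
      outputMatrix (fun j : Fin M => (j : ℕ)) (fun _ => √(1 / M)) γ₂ =
      ((1 / M : ℝ) : ℂ) • (toeplitz M γ₁ - toeplitz M γ₂) := by
  ext i j
  simp only [outputMatrix, toeplitz, Matrix.sub_apply, Matrix.smul_apply, of_apply, smul_eq_mul]
  rw [Real.mul_self_sqrt (by positivity)]
  push_cast
  ring

theorem alphaPlus_eq (γ₁ γ₂ : ℝ≥0) (E : ℝ) :
    alphaPlus γ₁ γ₂ E = matrixTraceNorm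
      (outputMatrix (fun j : Fin (⌊2 * E⌋₊ + 1) => (j : ℕ)) (fun _ => √(1 / (⌊2 * E⌋₊ + 1 : ℕ))) γ₁ -
        outputMatrix (fun j : Fin (⌊2 * E⌋₊ + 1) => (j : ℕ))
          (fun _ => √(1 / (⌊2 * E⌋₊ + 1 : ℕ))) γ₂) ^ 2 / 4 := by
  rw [outputMatrix_uniform_sub, matrixTraceNorm_smul (by positivity), alphaPlus]
  push_cast
  ring

theorem sum_uniform_sq (N : ℕ) : ∑ _j : Fin (N + 1), √(1 / (N + 1 : ℕ)) ^ 2 = 1 := by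
  rw [Real.sq_sqrt (by positivity), Finset.sum_const, Finset.card_univ, Fintype.card_fin,
    nsmul_eq_mul]
  field_simp

theorem sum_uniform_energy (N : ℕ) :
    ∑ j : Fin (N + 1), ((j : ℕ) : ℝ) * √(1 / (N + 1 : ℕ)) ^ 2 = N / 2 := by
  have h : ∀ N : ℕ, ∑ j ∈ Finset.range (N + 1), (j : ℝ) = N * (N + 1) / 2 := by
    intro N
    induction N with
    | zero => simp
    | succ N ih => rw [Finset.sum_range_succ, ih]; push_cast; ring
  rw [Real.sq_sqrt (by positivity), ← Finset.sum_mul,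
    Fin.sum_univ_eq_sum_range (fun j => (j : ℝ)) (N + 1), h]
  push_cast
  field_simp

theorem alphaPlus_pos {γ₁ γ₂ : ℝ≥0} (h : γ₁ ≠ γ₂) {E : ℝ} (hE : 1 / 2 ≤ E) :
    0 < alphaPlus γ₁ γ₂ E := by
  rw [alphaPlus_eq]
  refine div_pos (pow_pos (matrixTraceNorm_pos
    ((outputMatrix_isHermitian _ _ _).sub (outputMatrix_isHermitian _ _ _)) fun h0 => ?_) 2)
    (by norm_num)
  rw [outputMatrix_uniform_sub] at h0
  have hM : (0 : ℝ) < 1 / (⌊2 * E⌋₊ + 1 : ℕ) := by positivity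
  have h1 := (smul_eq_zero.1 h0).resolve_left (Complex.ofReal_ne_zero.2 hM.ne')
  -- `E ≥ 1/2` guarantees two levels, so the entry `(1, 0)` exists; it separates distinct values of
  -- `γ`.
  have hfl : 1 < ⌊2 * E⌋₊ + 1 := by
    have : 1 ≤ ⌊2 * E⌋₊ := Nat.le_floor (by push_cast; linarith)
    omega
  have h2 := congrFun (congrFun h1 ⟨1, hfl⟩) ⟨0, by omega⟩
  simp only [toeplitz, Matrix.sub_apply, of_apply, Matrix.zero_apply, ← Complex.ofReal_sub,
    Complex.ofReal_eq_zero] at h2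
  exact exp_decay_ne h (by simp) (sub_eq_zero.1 h2)

/-- Dephasing leaves the populations alone, so the difference is antidiagonal with real entry `t`
and trace norm `2|t|`; thus `α₋ = t²`. -/
theorem alphaMinus_eq (γ₁ γ₂ : ℝ≥0) {E : ℝ} {m : ℕ} (h0 : 0 ≤ E / m) (h1 : E / m ≤ 1) :
    alphaMinus γ₁ γ₂ E m = matrixTraceNorm
      (outputMatrix ![0, m] ![√(1 - E / m), √(E / m)] γ₁ -
        outputMatrix ![0, m] ![√(1 - E / m), √(E / m)] γ₂) ^ 2 / 4 := by
  set p := E / m with hp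
  have hmat : outputMatrix ![0, m] ![√(1 - p), √p] γ₁ - outputMatrix ![0, m] ![√(1 - p), √p] γ₂ =
      !![0, ((√(1 - p) * √p * (Real.exp (-(m : ℝ) ^ 2 / 2 * γ₁) -
        Real.exp (-(m : ℝ) ^ 2 / 2 * γ₂)) : ℝ) : ℂ);
        ((√(1 - p) * √p * (Real.exp (-(m : ℝ) ^ 2 / 2 * γ₁) -
          Real.exp (-(m : ℝ) ^ 2 / 2 * γ₂)) : ℝ) : ℂ), 0] := by
    have e : ∀ γ : ℝ≥0, -(m : ℝ) ^ 2 / 2 * (γ : ℝ) = -(γ : ℝ) / 2 * (m : ℝ) ^ 2 := fun γ => by ring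
    ext i j
    simp only [e]
    fin_cases i <;> fin_cases j <;> simp [outputMatrix] <;> ring
  rw [hmat, matrixTraceNorm_antidiagonal, mul_pow, sq_abs, mul_pow, mul_pow,
    Real.sq_sqrt (by linarith), Real.sq_sqrt h0, alphaMinus, ← hp, sq_abs]
  ring

theorem alphaMinus_pos {γ₁ γ₂ : ℝ≥0} (h : γ₁ ≠ γ₂) {E : ℝ} {m : ℕ} (hm : m ≠ 0)
    (h0 : 0 < E / m) (h1 : E / m < 1) : 0 < alphaMinus γ₁ γ₂ E m := by
  have e : ∀ γ : ℝ≥0, -(m : ℝ) ^ 2 / 2 * (γ : ℝ) = -(γ : ℝ) / 2 * (m : ℝ) ^ 2 := fun γ => by ring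
  have hne := exp_decay_ne h (Nat.cast_ne_zero (R := ℝ).2 hm)
  rw [alphaMinus, e, e]
  have := abs_pos.2 (sub_ne_zero.2 hne)
  have : 0 < 1 - E / m := by linarith
  positivity

theorem IsMStar.ne_zero {q₁ q₂ : ℝ} {γ₁ γ₂ : ℝ≥0} {m : ℕ} (h : IsMStar q₁ q₂ γ₁ γ₂ m) :
    m ≠ 0 := by
  rcases h with rfl | ⟨h, -⟩ <;> omega

end Inputs

end BosonicDephasing

theorem theorem7 (n : ℕ) (q₁ q₂ : ℝ) (hq₁ : 0 ≤ q₁) (hq₂ : 0 ≤ q₂) (hq : q₁ + q₂ = 1)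
    (γ₁ γ₂ : ℝ≥0) (E : ℝ) (hE : 0 ≤ E) :
    ∃ D : ℝ≥0,
      -- `D` is the (finite, attained) maximum of the trace norm over the admissible inputs
      IsGreatest
        ((fun ρ => BosonicDephasing.traceNorm (BosonicDephasing.fockBasis n)
          (BosonicDephasing.delta n q₁ q₂ γ₁ γ₂ ρ)) '' BosonicDephasing.admissible n E)
        (D : ℝ≥0∞) ∧
      (1 / 2 ≤ E →
        BosonicDephasing.alphaPlus γ₁ γ₂ E < 1 ∧
        (γ₁ ≠ γ₂ → 0 < BosonicDephasing.alphaPlus γ₁ γ₂ E) ∧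
        1 - 2 * √(q₁ * q₂) * (1 - BosonicDephasing.alphaPlus γ₁ γ₂ E) ^ ((n : ℝ) / 2) ≤ D ∧
        ∃ ρ ∈ BosonicDephasing.admissible n E,
          ∃ Q : BosonicDephasing.Fock n →L[ℂ] BosonicDephasing.Fock n, 0 ≤ Q ∧ Q ≤ 1 ∧
            BosonicDephasing.errorProb n q₁ q₂ γ₁ γ₂ ρ Q ≤
              1 / 2 * Real.exp (n * Real.log √(1 - BosonicDephasing.alphaPlus γ₁ γ₂ E))) ∧
      (E < 1 / 2 →
        ∀ m : ℕ, BosonicDephasing.IsMStar q₁ q₂ γ₁ γ₂ m ∨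
            BosonicDephasing.IsMStar (1 / 2) (1 / 2) γ₁ γ₂ m →
          BosonicDephasing.alphaMinus γ₁ γ₂ E m < 1 ∧
          (γ₁ ≠ γ₂ → 0 < E → 0 < BosonicDephasing.alphaMinus γ₁ γ₂ E m) ∧
          1 - 2 * √(q₁ * q₂) * (1 - BosonicDephasing.alphaMinus γ₁ γ₂ E m) ^ ((n : ℝ) / 2) ≤ D ∧
          ∃ ρ ∈ BosonicDephasing.admissible n E,
            ∃ Q : BosonicDephasing.Fock n →L[ℂ] BosonicDephasing.Fock n, 0 ≤ Q ∧ Q ≤ 1 ∧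
              BosonicDephasing.errorProb n q₁ q₂ γ₁ γ₂ ρ Q ≤
                1 / 2 * Real.exp (n * Real.log √(1 - BosonicDephasing.alphaMinus γ₁ γ₂ E m))) := by
  obtain ⟨D, hD⟩ := BosonicDephasing.exists_isGreatest_traceNorm_delta n hq₁ hq₂ hq γ₁ γ₂ hE
  have le_D : ∀ {x : ℝ} {ρ}, ρ ∈ BosonicDephasing.admissible n E →
      ENNReal.ofReal x ≤ BosonicDephasing.traceNorm (BosonicDephasing.fockBasis n)
        (BosonicDephasing.delta n q₁ q₂ γ₁ γ₂ ρ) → x ≤ D := fun hρ h => by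
    have h1 := h.trans (hD.2 (Set.mem_image_of_mem _ hρ))
    rw [← ENNReal.ofReal_coe_nnreal] at h1
    exact (ENNReal.ofReal_le_ofReal_iff D.2).1 h1
  refine ⟨D, hD, fun hE2 => ?_, fun hE2 m hm => ?_⟩
  · obtain ⟨hα, ρ, hρ, h1, Q, hQ⟩ := BosonicDephasing.product_input_bounds n hq₁ hq₂ hq γ₁ γ₂
      (E := E) Fin.val_injective (BosonicDephasing.sum_uniform_sq _)
      ((BosonicDephasing.sum_uniform_energy ⌊2 * E⌋₊).le.trans
        (by linarith [Nat.floor_le (show 0 ≤ 2 * E by linarith)]))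
      (BosonicDephasing.alphaPlus_eq γ₁ γ₂ E)
    exact ⟨hα, fun h => BosonicDephasing.alphaPlus_pos h hE2, le_D hρ h1, ρ, hρ, Q, hQ⟩
  · have hm0 : m ≠ 0 := hm.elim BosonicDephasing.IsMStar.ne_zero BosonicDephasing.IsMStar.ne_zero
    have hm1 : (1 : ℝ) ≤ m := by exact_mod_cast Nat.one_le_iff_ne_zero.2 hm0
    have hp0 : 0 ≤ E / m := by positivity
    -- `E < 1/2 < 1 ≤ m` makes `E / m` a legitimate weight for the level `m`.
    have hp1 : E / m < 1 := by
      rw [div_lt_one (by linarith)]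
      linarith
    obtain ⟨hα, ρ, hρ, h1, Q, hQ⟩ := BosonicDephasing.product_input_bounds n hq₁ hq₂ hq γ₁ γ₂
      (E := E) (ℓ := ![0, m]) (a := ![√(1 - E / m), √(E / m)])
      (fun i j h => by
        fin_cases i <;> fin_cases j <;> simp_all)
      (by
        rw [Fin.sum_univ_two]
        simp only [Matrix.cons_val_zero, Matrix.cons_val_one]
        rw [Real.sq_sqrt (by linarith), Real.sq_sqrt hp0]
        ring)
      (by
        rw [Fin.sum_univ_two]
        simp only [Matrix.cons_val_zero, Matrix.cons_val_one]
        rw [Real.sq_sqrt hp0, Nat.cast_zero, zero_mul, zero_add,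
          mul_div_cancel₀ _ (by linarith : (m : ℝ) ≠ 0)])
      (BosonicDephasing.alphaMinus_eq γ₁ γ₂ hp0 hp1.le)
    exact ⟨hα, fun h hE0 => BosonicDephasing.alphaMinus_pos h hm0
      (div_pos hE0 (by linarith)) hp1, le_D hρ h1, ρ, hρ, Q, hQ⟩
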